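/- Edge Clique Cover is the following problem: given a finite simple graph $G$ and an integer $k\ge 0$, decide whether there are at most $k$ cliques of $G$ such that every edge of $G$ is contained in at least one of them. For $r\ge 1$ let $c_r$ be the infimum of all reals $c>0$ for which there is an algorithm that decides satisfiability of every $n$-variable CNF formula with at most $r$ literals per clause (and without repeated clauses) in time $O(2^{cn})$. The Exponential Time Hypothesis (ETH) asserts that $c_3>0$. **Corollary.** Assume ETH. Then there are no function $f:\mathbb{N}\to\mathbb{R}$ with $f(k)=o(k)$ as $k\to\infty$ and no integer $d\ge 0$ for which some algorithm solves Edge Clique Cover on all instances $(G,k)$ in time $O\bigl(2^{2^{f(k)}}\cdot|V(G)|^{d}\bigr)$. In other words, unless ETH fails, Edge Clique Cover cannot be solved in time $O\bigl(2^{2^{o(k)}}\,|V(G)|^{O(1)}\bigr)$. Here algorithms are deterministic multi-tape Turing machines (tapes may equivalently be given as stacks), and the factor $|V(G)|^{d}$ is read as $1$ for the graph without vertices. -/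

import Mathlib

open Turing

/-! ### Algorithms and running times -/

/-- `DecidesInTime enc P T`: there is a deterministic multi-stack Turing machine (with finitely many
stacks, finite alphabets, labels and internal states) which, started on the binary string `enc a`,
halts after at most `T a` steps and outputs the single bit telling whether `P a` holds, for every
instance `a`. -/
def DecidesInTime {α : Type} (enc : α → List Bool) (P : α → Prop) (T : α → ℝ) : Prop :=
  ∃ M : TM2ComputableAux Bool Bool, (∀ s, Finite (M.tm.Γ s)) ∧
    ∀ a : α, ∃ (b : Bool) (t : ℕ), (b = true ↔ P a) ∧ (t : ℝ) ≤ T a ∧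
      Nonempty (TM2OutputsInTime M.tm ((enc a).map M.inputAlphabet.symm)
        (some ([b].map M.outputAlphabet.symm)) t)

/-- Self-delimiting unary code of a natural number. -/
def unaryCode (n : ℕ) : List Bool := List.replicate n true ++ [false]

/-- Self-delimiting code of a list, given a self-delimiting code of its entries. -/
def listCode {α : Type} (e : α → List Bool) (l : List α) : List Bool :=
  l.flatMap (fun a => true :: e a) ++ [false]

/-! ### CNF satisfiability and the Exponential Time Hypothesis -/

/-- A formula in conjunctive normal form with clauses of at most `w` literals, without repeated
clauses. The literal `(i, true)` is the variable `i`, the literal `(i, false)` its negation. -/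
structure CNFFormula (w : ℕ) where
  /-- number of variables -/
  numVars : ℕ
  /-- the clauses -/
  clauses : List (List (Fin numVars × Bool))
  nodup : clauses.Nodup
  width : ∀ c ∈ clauses, c.length ≤ w

namespace CNFFormula

variable {w : ℕ}

/-- Some truth assignment makes a literal of every clause true. -/
def Satisfiable (φ : CNFFormula w) : Prop :=
  ∃ x : Fin φ.numVars → Bool, ∀ c ∈ φ.clauses, ∃ l ∈ c, x l.1 = l.2

/-- The number of variables, followed by the list of the clauses. Its length is polynomial in the
number of variables. -/
def code (φ : CNFFormula w) : List Bool :=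
  unaryCode φ.numVars ++
    listCode (listCode fun l : Fin φ.numVars × Bool => l.2 :: unaryCode l.1) φ.clauses

end CNFFormula

open scoped ENNReal in
/-- The infimum of the positive reals `c` such that satisfiability of `w`-CNF formulas with `n`
variables can be decided in time `O(2 ^ (c * n))`. -/
noncomputable def satExponent (w : ℕ) : ℝ≥0∞ :=
  ⨅ (c : ℝ) (_ : 0 < c ∧ ∃ A : ℝ, DecidesInTime (CNFFormula.code (w := w))
      CNFFormula.Satisfiable fun φ => A * (2 : ℝ) ^ (c * (φ.numVars : ℝ))),
    ENNReal.ofReal c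

/-- The Exponential Time Hypothesis. -/
def ExponentialTimeHypothesis : Prop := 0 < satExponent 3

/-! ### Edge Clique Cover -/

/-- An instance of Edge Clique Cover: a finite simple graph and a number of cliques. -/
structure ECCInstance where
  /-- number of vertices -/
  numVerts : ℕ
  /-- the graph -/
  G : SimpleGraph (Fin numVerts)
  /-- the number of cliques allowed -/
  k : ℕ

namespace ECCInstance

/-- There are (at most) `k` cliques of `G` such that each edge is contained in one of them. -/
def HasCover (I : ECCInstance) : Prop :=
  ∃ 𝒞 : Finset (Finset (Fin I.numVerts)), 𝒞.card ≤ I.k ∧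
    (∀ K ∈ 𝒞, I.G.IsClique (K : Set (Fin I.numVerts))) ∧
    ∀ u v, I.G.Adj u v → ∃ K ∈ 𝒞, u ∈ K ∧ v ∈ K

open scoped Classical in
/-- The number of vertices, the number of cliques, and the adjacency matrix row by row. -/
noncomputable def code (I : ECCInstance) : List Bool :=
  unaryCode I.numVerts ++ unaryCode I.k ++
    (List.finRange I.numVerts).flatMap fun u =>
      (List.finRange I.numVerts).map fun v => decide (I.G.Adj u v)

end ECCInstance

/-- Edge Clique Cover can be solved in time `O(2 ^ (2 ^ f(k)) * |V(G)| ^ d)`. For the graph without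
vertices the second factor is read as `1`, since no machine halts in time `0`. -/
def ECCSolvableInTime (f : ℕ → ℝ) (d : ℕ) : Prop :=
  ∃ A : ℝ, DecidesInTime ECCInstance.code ECCInstance.HasCover fun I =>
    A * ((2 : ℝ) ^ ((2 : ℝ) ^ f I.k) * ((max 1 I.numVerts : ℕ) : ℝ) ^ d)

/-! The heart is a polynomial-time reduction that turns a 3-CNF formula with `n` variables into an
Edge Clique Cover instance with polynomially many vertices but only `k = O(log n)` cliques. If `f(k)
= o(k)`, then `2 ^ f(k)` is at most a constant times `√(n + 1)`. A solver with running time `2 ^ (2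
^ f(k)) * |V| ^ d` would then decide 3-SAT in time `O(2 ^ (c * n))` for every `c > 0`, against ETH.

Satisfiability is encoded as a 4-colouring problem. Its elements are the literals, the occurrences
of literals in clauses, and copies of four palette colours. Literals must avoid two of the colours,
complementary literals differ, the three occurrences of a clause differ and avoid the colour
"false", and an occurrence differs from the literal opposite to it. So one occurrence in each clause
is coloured "true", and its literal is true (`exists_of_colourable`, `exists_colouring`).

Apart from finitely many cases that depend only on sorts and signs, two elements conflict when
certain indices are equal, so they are compatible when these indices differ in some binary digit. At
each of the `O(log n)` digit positions an element has one of 72 types, and a pair of related types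
at a position gives a set of pairwise compatible elements. These `72 * 72 * l` sets capture all
compatible pairs (`exists_mem_iff`).

`Node.exists_cover_iff` turns "four colours, equal colours only within a common set" into an edge
clique cover: one clique is forced for each set, and exactly four remain for the edges at `hub`, one
for each colour.

That the reduction takes polynomial time is proved on machines. Arithmetic expressions with capped
iteration (`Expr`) and descriptions of bit strings (`Out`) compile to a while-language on stacks
(`Prog`), which compiles to a stack machine that finally hands its output to the given solver
(`DecidesInTime.of_out`). -/

/-! ### A while-language on stacks of bits -/

/-- Programs acting on stacks of bits that are indexed by `ℕ`. `pop` branches on the popped symbol,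
`loop` pops a symbol and runs the corresponding body until the stack is empty. -/
inductive Prog
  | skip
  | push (k : ℕ) (a : Bool)
  | seq (P Q : Prog)
  | pop (k : ℕ) (P₀ P₁ P₂ : Prog)
  | loop (k : ℕ) (P₁ P₂ : Prog)

/-- Contents of the stacks. -/
abbrev Stacks := ℕ → List Bool

namespace Prog

open Function (update)

/-- A strict upper bound for the indices of the stacks used by a program. -/
def width : Prog → ℕ
  | skip => 0
  | push k _ => k + 1
  | seq P Q => max P.width Q.width
  | pop k P₀ P₁ P₂ => max (k + 1) (max P₀.width (max P₁.width P₂.width))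
  | loop k P₁ P₂ => max (k + 1) (max P₁.width P₂.width)

/-- `Runs P s s' t`: the program `P` transforms `s` into `s'` in exactly `t` steps. -/
inductive Runs : Prog → Stacks → Stacks → ℕ → Prop
  | skip (s) : Runs skip s s 1
  | push (k a s) : Runs (push k a) s (update s k (a :: s k)) 1
  | seq {P Q s s₁ s₂ t₁ t₂} : Runs P s s₁ t₁ → Runs Q s₁ s₂ t₂ → Runs (seq P Q) s s₂ (t₁ + t₂)
  | pop_nil {k P₀ P₁ P₂ s s' t} : s k = [] → Runs P₀ s s' t →
      Runs (pop k P₀ P₁ P₂) s s' (t + 1)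
  | pop_true {k P₀ P₁ P₂ s s' t l} : s k = true :: l → Runs P₁ (update s k l) s' t →
      Runs (pop k P₀ P₁ P₂) s s' (t + 1)
  | pop_false {k P₀ P₁ P₂ s s' t l} : s k = false :: l → Runs P₂ (update s k l) s' t →
      Runs (pop k P₀ P₁ P₂) s s' (t + 1)
  | loop_nil {k P₁ P₂ s} : s k = [] → Runs (loop k P₁ P₂) s s 1
  | loop_true {k P₁ P₂ s s₁ s₂ t₁ t₂ l} : s k = true :: l → Runs P₁ (update s k l) s₁ t₁ →
      Runs (loop k P₁ P₂) s₁ s₂ t₂ → Runs (loop k P₁ P₂) s s₂ (t₁ + t₂ + 1)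
  | loop_false {k P₁ P₂ s s₁ s₂ t₁ t₂ l} : s k = false :: l → Runs P₂ (update s k l) s₁ t₁ →
      Runs (loop k P₁ P₂) s₁ s₂ t₂ → Runs (loop k P₁ P₂) s s₂ (t₁ + t₂ + 1)

/-- Program positions. -/
def Lbl : Prog → Type
  | skip => Unit
  | push _ _ => Unit
  | seq P Q => P.Lbl ⊕ Q.Lbl
  | pop _ P₀ P₁ P₂ => Unit ⊕ (P₀.Lbl ⊕ (P₁.Lbl ⊕ P₂.Lbl))
  | loop _ P₁ P₂ => Unit ⊕ (P₁.Lbl ⊕ P₂.Lbl)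

theorem finite_lbl : ∀ P : Prog, Finite P.Lbl
  | skip => inferInstanceAs (Finite Unit)
  | push _ _ => inferInstanceAs (Finite Unit)
  | seq P Q => by
      have := finite_lbl P; have := finite_lbl Q
      exact inferInstanceAs (Finite (P.Lbl ⊕ Q.Lbl))
  | pop _ P₀ P₁ P₂ => by
      have := finite_lbl P₀; have := finite_lbl P₁; have := finite_lbl P₂
      exact inferInstanceAs (Finite (Unit ⊕ (P₀.Lbl ⊕ (P₁.Lbl ⊕ P₂.Lbl))))
  | loop _ P₁ P₂ => by
      have := finite_lbl P₁; have := finite_lbl P₂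
      exact inferInstanceAs (Finite (Unit ⊕ (P₁.Lbl ⊕ P₂.Lbl)))

/-- The position at which a program starts. -/
def start : (P : Prog) → P.Lbl
  | skip => ()
  | push _ _ => ()
  | seq P _ => Sum.inl P.start
  | pop _ _ _ _ => Sum.inl ()
  | loop _ _ _ => Sum.inl ()

/-! ### Simulation of programs, and of a given machine, by a machine with more stacks. -/

section Compile

variable {R : ℕ} {K : Type} {Γ : K → Type} {L σ : Type}

/-- The stack alphabets of a machine that has `R + 1` bit stacks besides given stacks. -/
@[reducible] def Alphabet (R : ℕ) (Γ : K → Type) : Fin (R + 1) ⊕ K → Type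
  | Sum.inl _ => Bool
  | Sum.inr k => Γ k

/-- The stack of the machine that represents the stack `k` of a program. -/
abbrev reg (R : ℕ) (K : Type) (k : ℕ) : Fin (R + 1) ⊕ K := Sum.inl (Fin.ofNat (R + 1) k)

/-- Branching on the symbol popped last. -/
def jump (l₀ l₁ l₂ : L) (v : Option Bool × σ) : L :=
  match v.1 with
  | none => l₀
  | some true => l₁
  | some false => l₂

/-- Translation of programs into statements of a stack machine. -/
def toStmt : (P : Prog) → (P.Lbl → L) → L → P.Lbl → TM2.Stmt (Alphabet R Γ) L (Option Bool × σ)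
  | skip, _, e => fun _ => .goto fun _ => e
  | push k a, _, e => fun _ => .push (reg R K k) (fun _ => a) (.goto fun _ => e)
  | seq P Q, ι, e => Sum.elim
      (P.toStmt (fun l => ι (Sum.inl l)) (ι (Sum.inr Q.start)))
      (Q.toStmt (fun l => ι (Sum.inr l)) e)
  | pop k P₀ P₁ P₂, ι, e => Sum.elim
      (fun _ => .pop (reg R K k) (fun v o => (o, v.2)) (.goto (jump
        (ι (Sum.inr (Sum.inl P₀.start))) (ι (Sum.inr (Sum.inr (Sum.inl P₁.start))))
        (ι (Sum.inr (Sum.inr (Sum.inr P₂.start)))))))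
      (Sum.elim (P₀.toStmt (fun l => ι (Sum.inr (Sum.inl l))) e)
        (Sum.elim (P₁.toStmt (fun l => ι (Sum.inr (Sum.inr (Sum.inl l)))) e)
          (P₂.toStmt (fun l => ι (Sum.inr (Sum.inr (Sum.inr l)))) e)))
  | loop k P₁ P₂, ι, e => Sum.elim
      (fun _ => .pop (reg R K k) (fun v o => (o, v.2)) (.goto (jump
        e (ι (Sum.inr (Sum.inl P₁.start))) (ι (Sum.inr (Sum.inr P₂.start))))))
      (Sum.elim (P₁.toStmt (fun l => ι (Sum.inr (Sum.inl l))) (ι (Sum.inl ())))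
        (P₂.toStmt (fun l => ι (Sum.inr (Sum.inr l))) (ι (Sum.inl ()))))

/-- The stacks of the machine: those of a program and the given ones. -/
def combine (R : ℕ) (s : Stacks) (S : ∀ k, List (Γ k)) : ∀ k, List (Alphabet R Γ k)
  | Sum.inl i => s i
  | Sum.inr k => S k

theorem combine_nil : combine R (fun _ => []) (fun k : K => ([] : List (Γ k))) = fun _ => [] := by
  funext k
  cases k <;> rfl

theorem combine_reg (s : Stacks) (S : ∀ k, List (Γ k)) {k : ℕ} (hk : k < R + 1) :
    combine R s S (reg R K k) = s k := by
  simp [combine, Nat.mod_eq_of_lt hk]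

variable [DecidableEq K]

theorem update_combine_reg (s : Stacks) (S : ∀ k, List (Γ k)) {k : ℕ} (hk : k < R + 1)
    (l : List Bool) :
    update (combine R s S) (reg R K k) l = combine R (update s k l) S := by
  funext j
  rcases j with j | j
  · by_cases h : j = Fin.ofNat (R + 1) k
    · subst h
      simp [combine, Nat.mod_eq_of_lt hk]
    · have h' : (j : ℕ) ≠ k := fun h' => h (Fin.ext (by simp [h', Nat.mod_eq_of_lt hk]))
      rw [Function.update_of_ne (by simpa using h)]
      simp [combine, Function.update_of_ne h']
  · simp [combine]

theorem update_combine_inr (s : Stacks) (S : ∀ k, List (Γ k)) (k : K) (l : List (Γ k)) :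
    update (combine R s S) (Sum.inr k) l = combine R s (update S k l) := by
  funext j
  rcases j with j | j
  · simp [combine]
  · by_cases h : j = k
    · subst h; simp [combine]
    · rw [Function.update_of_ne (by simpa using h)]
      simp [combine, Function.update_of_ne h]

variable {M : L → TM2.Stmt (Alphabet R Γ) L (Option Bool × σ)}

theorem stepAux_push_reg {k : ℕ} (hk : k < R + 1) (a : Bool) (e : L) (v : Option Bool × σ)
    (s : Stacks) (S : ∀ k, List (Γ k)) :
    TM2.stepAux (.push (reg R K k) (fun _ => a) (.goto fun _ => e)) v (combine R s S)
      = ⟨some e, v, combine R (update s k (a :: s k)) S⟩ := by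
  rw [← update_combine_reg s S hk, ← combine_reg s S hk]
  rfl

theorem stepAux_pop {k : ℕ} (hk : k < R + 1) (f : Option Bool × σ → Option Bool → Option Bool × σ)
    (q : TM2.Stmt (Alphabet R Γ) L (Option Bool × σ)) (v : Option Bool × σ)
    (s : Stacks) (S : ∀ k, List (Γ k)) :
    TM2.stepAux (.pop (reg R K k) f q) v (combine R s S)
      = TM2.stepAux q (f v (s k).head?) (combine R (update s k (s k).tail) S) := by
  rw [← update_combine_reg s S hk, ← combine_reg s S hk]
  rfl

theorem stepAux_push_inr (k : K) (f : Option Bool × σ → Γ k)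
    (q : TM2.Stmt (Alphabet R Γ) L (Option Bool × σ)) (v : Option Bool × σ)
    (s : Stacks) (S : ∀ k, List (Γ k)) :
    TM2.stepAux (.push (Sum.inr k) f q) v (combine R s S)
      = TM2.stepAux q v (combine R s (update S k (f v :: S k))) := by
  rw [← update_combine_inr]
  rfl

theorem stepAux_branch_of_true {f : Option Bool × σ → Bool} {v : Option Bool × σ} (h : f v = true)
    (q₁ q₂ : TM2.Stmt (Alphabet R Γ) L (Option Bool × σ)) (S : ∀ k, List (Alphabet R Γ k)) :
    TM2.stepAux (.branch f q₁ q₂) v S = TM2.stepAux q₁ v S := by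
  rw [TM2.stepAux, h, cond_true]

theorem iterate_step_succ (c : TM2.Cfg (Alphabet R Γ) L (Option Bool × σ)) (l : L)
    (v : Option Bool × σ) (S : ∀ k, List (Alphabet R Γ k)) (t : ℕ)
    (h : TM2.stepAux (M l) v S = c) :
    (flip bind (TM2.step M))^[t + 1] (some ⟨some l, v, S⟩)
      = (flip bind (TM2.step M))^[t] (some c) := by
  rw [Function.iterate_succ_apply, ← h]
  rfl

theorem iterate_step_add {a b : Option (TM2.Cfg (Alphabet R Γ) L (Option Bool × σ))} {t₁ : ℕ}
    (h : (flip bind (TM2.step M))^[t₁] a = b) (t₂ : ℕ) :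
    (flip bind (TM2.step M))^[t₁ + t₂] a = (flip bind (TM2.step M))^[t₂] b := by
  rw [Nat.add_comm t₁ t₂, Function.iterate_add_apply, h]

/-- Every position of a program performs one action and then jumps, so the step counts agree
exactly. The register for the last popped symbol ends in an unspecified state `o`, while the
register of the embedded machine is untouched. -/
theorem Runs.iterate_step {P : Prog} {s s' : Stacks} {t : ℕ} (h : Runs P s s' t)
    (hR : P.width ≤ R + 1) (ι : P.Lbl → L) (e : L) (hM : ∀ l, M (ι l) = P.toStmt ι e l)
    (v : Option Bool × σ) (S : ∀ k, List (Γ k)) :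
    ∃ o : Option Bool, (flip bind (TM2.step M))^[t] (some ⟨some (ι P.start), v, combine R s S⟩)
      = some ⟨some e, (o, v.2), combine R s' S⟩ := by
  induction h generalizing e v with
  | skip s =>
    refine ⟨v.1, iterate_step_succ _ _ _ _ 0 ?_⟩
    rw [hM]; rfl
  | push k a s =>
    refine ⟨v.1, iterate_step_succ _ _ _ _ 0 ?_⟩
    rw [hM]
    exact stepAux_push_reg (by simpa [width] using hR) _ _ _ _ _
  | @seq P Q s s₁ s₂ t₁ t₂ _ _ ih₁ ih₂ =>
    simp only [width, max_le_iff] at hR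
    obtain ⟨o₁, h₁⟩ := ih₁ hR.1 (fun l => ι (Sum.inl l)) (ι (Sum.inr Q.start))
      (fun l => hM (Sum.inl l)) v
    obtain ⟨o₂, h₂⟩ := ih₂ hR.2 (fun l => ι (Sum.inr l)) e (fun l => hM (Sum.inr l)) (o₁, v.2)
    exact ⟨o₂, (iterate_step_add h₁ t₂).trans h₂⟩
  | @pop_nil k P₀ P₁ P₂ s s' t hs _ ih =>
    simp only [width, max_le_iff] at hR
    obtain ⟨o, h⟩ := ih hR.2.1 (fun l => ι (Sum.inr (Sum.inl l))) e
      (fun l => hM (Sum.inr (Sum.inl l))) (none, v.2)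
    refine ⟨o, (iterate_step_succ _ _ _ _ t ?_).trans h⟩
    rw [hM]
    refine (stepAux_pop hR.1 _ _ _ _ _).trans ?_
    rw [hs, List.tail_nil, ← hs, Function.update_eq_self, hs]
    rfl
  | @pop_true k P₀ P₁ P₂ s s' t l hs _ ih =>
    simp only [width, max_le_iff] at hR
    obtain ⟨o, h⟩ := ih hR.2.2.1 (fun l => ι (Sum.inr (Sum.inr (Sum.inl l)))) e
      (fun l => hM (Sum.inr (Sum.inr (Sum.inl l)))) (some true, v.2)
    refine ⟨o, (iterate_step_succ _ _ _ _ t ?_).trans h⟩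
    rw [hM]
    refine (stepAux_pop hR.1 _ _ _ _ _).trans ?_
    rw [hs]
    rfl
  | @pop_false k P₀ P₁ P₂ s s' t l hs _ ih =>
    simp only [width, max_le_iff] at hR
    obtain ⟨o, h⟩ := ih hR.2.2.2 (fun l => ι (Sum.inr (Sum.inr (Sum.inr l)))) e
      (fun l => hM (Sum.inr (Sum.inr (Sum.inr l)))) (some false, v.2)
    refine ⟨o, (iterate_step_succ _ _ _ _ t ?_).trans h⟩
    rw [hM]
    refine (stepAux_pop hR.1 _ _ _ _ _).trans ?_
    rw [hs]
    rfl
  | @loop_nil k P₁ P₂ s hs =>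
    simp only [width, max_le_iff] at hR
    refine ⟨none, iterate_step_succ _ _ _ _ 0 ?_⟩
    rw [hM]
    refine (stepAux_pop hR.1 _ _ _ _ _).trans ?_
    rw [hs, List.tail_nil, ← hs, Function.update_eq_self, hs]
    rfl
  | @loop_true k P₁ P₂ s s₁ s₂ t₁ t₂ l hs _ _ ih₁ ih₂ =>
    have hR' := hR
    simp only [width, max_le_iff] at hR
    obtain ⟨o₁, h₁⟩ := ih₁ hR.2.1 (fun l => ι (Sum.inr (Sum.inl l))) (ι (Sum.inl ()))
      (fun l => hM (Sum.inr (Sum.inl l))) (some true, v.2)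
    obtain ⟨o₂, h₂⟩ := ih₂ hR' ι e hM (o₁, v.2)
    refine ⟨o₂, (iterate_step_succ _ _ _ _ _ ?_).trans ((iterate_step_add h₁ t₂).trans h₂)⟩
    rw [hM]
    refine (stepAux_pop hR.1 _ _ _ _ _).trans ?_
    rw [hs]
    rfl
  | @loop_false k P₁ P₂ s s₁ s₂ t₁ t₂ l hs _ _ ih₁ ih₂ =>
    have hR' := hR
    simp only [width, max_le_iff] at hR
    obtain ⟨o₁, h₁⟩ := ih₁ hR.2.2 (fun l => ι (Sum.inr (Sum.inr l))) (ι (Sum.inl ()))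
      (fun l => hM (Sum.inr (Sum.inr l))) (some false, v.2)
    obtain ⟨o₂, h₂⟩ := ih₂ hR' ι e hM (o₁, v.2)
    refine ⟨o₂, (iterate_step_succ _ _ _ _ _ ?_).trans ((iterate_step_add h₁ t₂).trans h₂)⟩
    rw [hM]
    refine (stepAux_pop hR.1 _ _ _ _ _).trans ?_
    rw [hs]
    rfl

/-- Statements of a machine as statements of a machine with more stacks. -/
def lift {Λ : Type} (j : Λ → L) : TM2.Stmt Γ Λ σ → TM2.Stmt (Alphabet R Γ) L (Option Bool × σ)
  | .push k f q => .push (Sum.inr k) (fun v => f v.2) (lift j q)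
  | .peek k f q => .peek (Sum.inr k) (fun v o => (v.1, f v.2 o)) (lift j q)
  | .pop k f q => .pop (Sum.inr k) (fun v o => (v.1, f v.2 o)) (lift j q)
  | .load f q => .load (fun v => (v.1, f v.2)) (lift j q)
  | .branch f q₁ q₂ => .branch (fun v => f v.2) (lift j q₁) (lift j q₂)
  | .goto f => .goto fun v => j (f v.2)
  | .halt => .halt

/-- Configurations of a machine as configurations of a machine with more stacks. -/
def liftCfg {Λ : Type} (j : Λ → L) (s : Stacks) (c : TM2.Cfg Γ Λ σ) :
    TM2.Cfg (Alphabet R Γ) L (Option Bool × σ) :=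
  ⟨c.l.map j, (none, c.var), combine R s c.stk⟩

theorem stepAux_lift {Λ : Type} (j : Λ → L) (q : TM2.Stmt Γ Λ σ) (v : σ) (s : Stacks)
    (S : ∀ k, List (Γ k)) :
    TM2.stepAux (lift (R := R) j q) (none, v) (combine R s S)
      = liftCfg j s (TM2.stepAux q v S) := by
  induction q generalizing v S with
  | push k f q ih =>
    simp only [lift, TM2.stepAux, update_combine_inr, ← ih]; rfl
  | peek k f q ih => simp only [lift, TM2.stepAux, ← ih]; rfl
  | pop k f q ih => simp only [lift, TM2.stepAux, update_combine_inr, ← ih]; rfl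
  | load f q ih => simp only [lift, TM2.stepAux, ← ih]
  | branch f q₁ q₂ ih₁ ih₂ =>
    simp only [lift, TM2.stepAux]
    cases f v <;> simp [ih₁, ih₂]
  | goto f => rfl
  | halt => rfl

/-- Lifted statements ignore the program stacks and the pop register, so the larger machine runs `N`
in lockstep, also after halting. -/
theorem iterate_step_liftCfg {Λ : Type} {N : Λ → TM2.Stmt Γ Λ σ} (j : Λ → L)
    (hM : ∀ l, M (j l) = lift j (N l)) (s : Stacks) (t : ℕ) (c : Option (TM2.Cfg Γ Λ σ)) :
    (flip bind (TM2.step M))^[t] (c.map (liftCfg j s))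
      = ((flip bind (TM2.step N))^[t] c).map (liftCfg j s) := by
  induction t generalizing c with
  | zero => rfl
  | succ t ih =>
    rw [Function.iterate_succ_apply, Function.iterate_succ_apply, ← ih]
    congr 1
    rcases c with _ | ⟨_ | l, v, S⟩
    · rfl
    · rfl
    · simp [flip, liftCfg, TM2.step, hM, stepAux_lift]

end Compile

theorem initList_eq (M : FinTM2) (l : List (M.Γ M.k₀)) :
    initList M l = ⟨some M.main, M.initialState, update (fun _ => []) M.k₀ l⟩ := by
  unfold initList
  congr 1
  funext k
  by_cases h : k = M.k₀
  · subst h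
    simp
  · simp [h]

theorem haltList_eq (M : FinTM2) (l : List (M.Γ M.k₁)) :
    haltList M l = ⟨none, M.initialState, update (fun _ => []) M.k₁ l⟩ := by
  unfold haltList
  congr 1
  funext k
  by_cases h : k = M.k₁
  · subst h
    simp
  · simp [h]

/-- The machine that runs a program, moves the contents of stack `1` to the input stack of `M`, and
continues as `M`. -/
noncomputable def machine (P : Prog) (M : TM2ComputableAux Bool Bool) : FinTM2 :=
  letI := M.tm.kDecidableEq
  letI := M.tm.kFin
  letI := M.tm.σFin
  letI := M.tm.ΛFin
  letI := P.finite_lbl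
  { K := Fin (max P.width 2 + 1) ⊕ M.tm.K
    k₀ := reg _ _ 0
    k₁ := Sum.inr M.tm.k₁
    Γ := Alphabet (max P.width 2) M.tm.Γ
    Λ := P.Lbl ⊕ (Unit ⊕ M.tm.Λ)
    main := Sum.inl P.start
    ΛFin := Fintype.ofFinite _
    σ := Option Bool × M.tm.σ
    initialState := (none, M.tm.initialState)
    Γk₀Fin := inferInstanceAs (Fintype Bool)
    m := Sum.elim (P.toStmt Sum.inl (Sum.inr (Sum.inl ())))
      (Sum.elim
        (fun _ => .pop (reg _ _ 1) (fun v o => (o, v.2))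
          (.branch (fun v => v.1.isSome)
            (.push (Sum.inr M.tm.k₀) (fun v => M.inputAlphabet.symm (v.1.getD false))
              (.goto fun _ => Sum.inr (Sum.inl ())))
            (.goto fun _ => Sum.inr (Sum.inr M.tm.main))))
        (fun l => lift (fun l => Sum.inr (Sum.inr l)) (M.tm.m l))) }

/-! ### Handing the output of a program over to a given machine. -/

section Machine

variable (P : Prog) (M : TM2ComputableAux Bool Bool)

theorem initList_machine (l : List Bool) :
    initList (P.machine M) l = ⟨some (Sum.inl P.start), (none, M.tm.initialState),
      combine _ (update (fun _ => []) 0 l) fun _ => []⟩ := by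
  let _ := M.tm.kDecidableEq
  refine (initList_eq _ _).trans ?_
  rw [← update_combine_reg _ _ (by omega) l, combine_nil]
  rfl

theorem liftCfg_haltList (l : List (M.tm.Γ M.tm.k₁)) :
    (liftCfg (R := max P.width 2) (fun l => Sum.inr (Sum.inr l)) (fun _ => []) (haltList M.tm l) :
      (P.machine M).Cfg) = haltList (P.machine M) l := by
  let _ := M.tm.kDecidableEq
  have h := update_combine_inr (R := max P.width 2) (fun _ => []) (fun _ => []) M.tm.k₁ l
  rw [combine_nil] at h
  refine (congrArg _ (haltList_eq M.tm l)).trans (Eq.trans ?_ (haltList_eq (P.machine M) l).symm)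
  exact congrArg (TM2.Cfg.mk none (none, M.tm.initialState)) h.symm

theorem step_transfer (l : List Bool) (l' : List (M.tm.Γ M.tm.k₀)) (o : Option Bool) (a : Bool) :
    let _ := M.tm.kDecidableEq
    (P.machine M).step ⟨some (Sum.inr (Sum.inl ())), (o, M.tm.initialState),
        combine _ (update (fun _ => []) 1 (a :: l)) (update (fun _ => []) M.tm.k₀ l')⟩
      = some ⟨some (Sum.inr (Sum.inl ())), (some a, M.tm.initialState),
        combine _ (update (fun _ => []) 1 l)
          (update (fun _ => []) M.tm.k₀ (M.inputAlphabet.symm a :: l'))⟩ := by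
  intro _
  refine congrArg some ((stepAux_pop (by omega) _ _ _ _ _).trans
    ((stepAux_branch_of_true (by simp) _ _ _).trans ((stepAux_push_inr _ _ _ _ _ _).trans ?_)))
  simp [TM2.stepAux]
  rfl

theorem step_transfer_nil (l' : List (M.tm.Γ M.tm.k₀)) (o : Option Bool) :
    let _ := M.tm.kDecidableEq
    (P.machine M).step ⟨some (Sum.inr (Sum.inl ())), (o, M.tm.initialState),
        combine _ (fun _ => []) (update (fun _ => []) M.tm.k₀ l')⟩
      = some ⟨some (Sum.inr (Sum.inr M.tm.main)), (none, M.tm.initialState),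
        combine _ (fun _ => []) (update (fun _ => []) M.tm.k₀ l')⟩ := by
  intro _
  have h := update_combine_reg (R := max P.width 2) (fun _ => [])
    (update (fun _ => []) M.tm.k₀ l') (k := 1) (by omega) []
  have e : (update (fun _ => []) 1 [] : Stacks) = fun _ => [] := Function.update_eq_self _ _
  rw [e] at h
  exact congrArg (fun S => some (TM2.Cfg.mk (some (Sum.inr (Sum.inr M.tm.main)))
    (none, M.tm.initialState) S)) h

/-- Moving symbols one by one reverses the word, so a program has to leave its output reversed on
stack `1`. The additional step is the pop from the empty stack; it resets the pop register to
`none`, as required by `liftCfg` and by the final configuration. -/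
theorem iterate_step_transfer (l : List Bool) (l' : List (M.tm.Γ M.tm.k₀)) (o : Option Bool)
    (S : ∀ k, List (M.tm.Γ k)) :
    let _ := M.tm.kDecidableEq
    S = update (fun _ => []) M.tm.k₀ l' →
    (flip bind (P.machine M).step)^[l.length + 1]
      (some ⟨some (Sum.inr (Sum.inl ())), (o, M.tm.initialState),
        combine _ (update (fun _ => []) 1 l) S⟩)
      = some ⟨some (Sum.inr (Sum.inr M.tm.main)), (none, M.tm.initialState),
        combine _ (fun _ => [])
          (update (fun _ => []) M.tm.k₀ (l.reverse.map M.inputAlphabet.symm ++ l'))⟩ := by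
  induction l generalizing l' o S with
  | nil =>
    rintro _ rfl
    have e : (update (fun _ => []) 1 [] : Stacks) = fun _ => [] := Function.update_eq_self _ _
    rw [e]
    exact step_transfer_nil P M l' o
  | cons a l ih =>
    rintro _ rfl
    rw [List.length_cons, Function.iterate_succ_apply]
    refine Eq.trans (congrArg _ (step_transfer P M l l' o a))
      ((ih (M.inputAlphabet.symm a :: l') (some a) _ rfl).trans ?_)
    simp
end Machine

end Prog

/-- Many-one reductions transfer decision procedures. The program must leave all stacks but `1`
empty, because in a halting configuration only the output stack may be nonempty. -/
theorem DecidesInTime.of_prog {α β : Type} {encα : α → List Bool} {encβ : β → List Bool}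
    {p : α → Prop} {q : β → Prop} {T : β → ℝ} (hq : DecidesInTime encβ q T) (r : α → β)
    (hr : ∀ a, q (r a) ↔ p a) (P : Prog) (t : α → ℕ)
    (hP : ∀ a, ∃ t' ≤ t a, P.Runs (Function.update (fun _ => []) 0 (encα a))
      (Function.update (fun _ => []) 1 (encβ (r a)).reverse) t') :
    DecidesInTime encα p fun a => t a + (encβ (r a)).length + 1 + T (r a) := by
  obtain ⟨M, hΓ, hM⟩ := hq
  let _ := M.tm.kDecidableEq
  refine ⟨⟨P.machine M, Equiv.refl Bool, M.outputAlphabet⟩, ?_, fun a => ?_⟩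
  · rintro (k | k)
    · exact inferInstanceAs (Finite Bool)
    · exact hΓ k
  obtain ⟨b, t₂, hb, ht₂, ⟨h₂⟩⟩ := hM (r a)
  obtain ⟨t₁, ht₁, h₁⟩ := hP a
  refine ⟨b, t₁ + ((encβ (r a)).length + 1) + h₂.steps, hb.trans (hr a), ?_, ⟨⟨⟨_, ?_⟩, le_rfl⟩⟩⟩
  · have : (h₂.steps : ℝ) ≤ t₂ := by exact_mod_cast h₂.steps_le_m
    have : (t₁ : ℝ) ≤ t a := by exact_mod_cast ht₁
    push_cast
    linarith
  · obtain ⟨o, e₁⟩ := h₁.iterate_step (M := (P.machine M).m) (R := max P.width 2) (by omega) Sum.inl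
      (Sum.inr (Sum.inl ())) (fun l => rfl) (none, M.tm.initialState) (fun _ => [])
    have e₂ := Prog.iterate_step_transfer P M (encβ (r a)).reverse [] o (fun _ => [])
      (Function.update_eq_self _ _).symm
    have e₃ := Prog.iterate_step_liftCfg (R := max P.width 2) (M := (P.machine M).m) (N := M.tm.m)
      (fun l => Sum.inr (Sum.inr l)) (fun l => rfl) (fun _ => []) h₂.steps
      (some (initList M.tm ((encβ (r a)).map M.inputAlphabet.symm)))
    have e₄ := h₂.evals_in_steps
    rw [List.reverse_reverse, List.append_nil, List.length_reverse] at e₂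
    rw [Nat.add_comm, Function.iterate_add_apply, Nat.add_comm t₁, Function.iterate_add_apply]
    have e₆ : (encα a).map (Equiv.refl Bool).symm = encα a := List.map_id _
    have e₅ := (congrArg (flip bind (P.machine M).step)^[(encβ (r a)).length + 1]
      ((congrArg (fun c => (flip bind (P.machine M).step)^[t₁] (some c))
        (Prog.initList_machine P M (encα a))).trans e₁)).trans e₂
    refine (congrArg _ ((congrArg (fun l => (flip bind (P.machine M).step)^[(encβ (r a)).length + 1]
      ((flip bind (P.machine M).step)^[t₁] (some (initList (P.machine M) l)))) e₆).trans e₅)).trans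
      (Eq.trans (congrArg _ ?_) (e₃.trans ((congrArg _ e₄).trans ?_)))
    · rw [Prog.initList_eq]
      rfl
    · exact congrArg some (Prog.liftCfg_haltList P M _)

/-! ### Time bounds for basic programs. -/

namespace Prog

open Function (update)

/-- The program `P` transforms `s` into `s'` in at most `T` steps. -/
def RunsIn (P : Prog) (s s' : Stacks) (T : ℕ) : Prop := ∃ t ≤ T, Runs P s s' t

section RunsIn

variable {P Q P₀ P₁ P₂ : Prog} {s s₁ s₂ : Stacks} {T T' : ℕ} {k j : ℕ}

theorem RunsIn.mono (h : RunsIn P s s₁ T) (hT : T ≤ T') : RunsIn P s s₁ T' :=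
  let ⟨t, ht, hr⟩ := h
  ⟨t, ht.trans hT, hr⟩

theorem RunsIn.congr (h : RunsIn P s s₁ T) (hs : s₁ = s₂) : RunsIn P s s₂ T := hs ▸ h

theorem RunsIn.skip (s : Stacks) : RunsIn skip s s 1 := ⟨1, le_rfl, .skip s⟩

theorem RunsIn.push (k : ℕ) (a : Bool) (s : Stacks) :
    RunsIn (push k a) s (update s k (a :: s k)) 1 := ⟨1, le_rfl, .push k a s⟩

theorem RunsIn.seq (h₁ : RunsIn P s s₁ T) (h₂ : RunsIn Q s₁ s₂ T') :
    RunsIn (seq P Q) s s₂ (T + T') :=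
  let ⟨_, ht₁, hr₁⟩ := h₁
  let ⟨_, ht₂, hr₂⟩ := h₂
  ⟨_, Nat.add_le_add ht₁ ht₂, .seq hr₁ hr₂⟩

theorem RunsIn.pop_nil (hs : s k = []) (h : RunsIn P₀ s s₁ T) :
    RunsIn (pop k P₀ P₁ P₂) s s₁ (T + 1) :=
  let ⟨_, ht, hr⟩ := h
  ⟨_, Nat.succ_le_succ ht, .pop_nil hs hr⟩

theorem RunsIn.pop_true {l : List Bool} (hs : s k = true :: l)
    (h : RunsIn P₁ (update s k l) s₁ T) : RunsIn (pop k P₀ P₁ P₂) s s₁ (T + 1) :=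
  let ⟨_, ht, hr⟩ := h
  ⟨_, Nat.succ_le_succ ht, .pop_true hs hr⟩

theorem RunsIn.pop_false {l : List Bool} (hs : s k = false :: l)
    (h : RunsIn P₂ (update s k l) s₁ T) : RunsIn (pop k P₀ P₁ P₂) s s₁ (T + 1) :=
  let ⟨_, ht, hr⟩ := h
  ⟨_, Nat.succ_le_succ ht, .pop_false hs hr⟩

theorem RunsIn.loop_nil (hs : s k = []) : RunsIn (loop k P₁ P₂) s s 1 :=
  ⟨1, le_rfl, .loop_nil hs⟩

theorem RunsIn.loop_cons {a : Bool} {l : List Bool} (hs : s k = a :: l)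
    (h₁ : RunsIn (cond a P₁ P₂) (update s k l) s₁ T) (h₂ : RunsIn (loop k P₁ P₂) s₁ s₂ T') :
    RunsIn (loop k P₁ P₂) s s₂ (T + T' + 1) := by
  obtain ⟨_, ht₁, hr₁⟩ := h₁
  obtain ⟨_, ht₂, hr₂⟩ := h₂
  cases a
  · exact ⟨_, by omega, .loop_false hs hr₁ hr₂⟩
  · exact ⟨_, by omega, .loop_true hs hr₁ hr₂⟩

/-- A loop controlled by a unary counter. -/
theorem RunsIn.loop_unary (n : ℕ) (st : ℕ → Stacks) (h₀ : st 0 = s) (hn : st n = s₁)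
    (hk : ∀ i ≤ n, st i k = List.replicate (n - i) true)
    (hbody : ∀ i < n, RunsIn P₁ (update (st i) k (List.replicate (n - i - 1) true)) (st (i + 1)) T) :
    RunsIn (loop k P₁ P₂) s s₁ (n * (T + 1) + 1) := by
  subst h₀ hn
  suffices h : ∀ m i, i + m = n → RunsIn (loop k P₁ P₂) (st i) (st n) (m * (T + 1) + 1) from
    h n 0 (by omega)
  intro m
  induction m with
  | zero =>
    rintro i rfl
    exact (RunsIn.loop_nil (by simp [hk])).mono (by simp)
  | succ m ih =>
    intro i hi
    refine (RunsIn.loop_cons (a := true) (l := List.replicate (n - i - 1) true) ?_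
      (hbody i (by omega)) (ih (i + 1) (by omega))).mono (by rw [Nat.succ_mul]; omega)
    rw [hk i (by omega), ← List.replicate_succ]
    congr 1
    omega

end RunsIn

/-- Empty a stack. -/
def clear (k : ℕ) : Prog := loop k skip skip

theorem RunsIn.clear (k : ℕ) (s : Stacks) :
    RunsIn (clear k) s (update s k []) (2 * (s k).length + 1) := by
  generalize hl : s k = l
  induction l generalizing s with
  | nil => exact (RunsIn.loop_nil hl).congr (by rw [← hl, Function.update_eq_self])
  | cons a l ih =>
    refine (RunsIn.loop_cons hl (T := 1) ?_ ((ih (update s k l) (by simp)).congr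
      (Function.update_idem ..))).mono (by simp; omega)
    cases a <;> exact RunsIn.skip _

/-- Move the contents of a stack to another stack, reversing the order. -/
def move (k j : ℕ) : Prog := loop k (push j true) (push j false)

theorem RunsIn.move {k j : ℕ} (hkj : k ≠ j) (s : Stacks) :
    RunsIn (move k j) s (update (update s k []) j ((s k).reverse ++ s j))
      (2 * (s k).length + 1) := by
  generalize hl : s k = l
  induction l generalizing s with
  | nil =>
    refine (RunsIn.loop_nil hl).congr ?_
    rw [← hl, Function.update_eq_self, hl, List.reverse_nil, List.nil_append,
      Function.update_eq_self]
  | cons a l ih =>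
    refine (RunsIn.loop_cons hl (T := 1) (s₁ := update (update s k l) j (a :: s j)) ?_
      ((ih _ ?_).congr ?_)).mono (by simp; omega)
    · cases a
      · exact (RunsIn.push _ _ _).congr (by simp [Function.update_of_ne hkj.symm])
      · exact (RunsIn.push _ _ _).congr (by simp [Function.update_of_ne hkj.symm])
    · simp [Function.update_of_ne hkj]
    · funext i
      simp only [Function.update_apply]
      split_ifs <;> simp_all

theorem RunsIn.move_unary {k j m n : ℕ} (hkj : k ≠ j) {s : Stacks}
    (hk : s k = List.replicate m true) (hj : s j = List.replicate n true) :
    RunsIn (Prog.move k j) s (update (update s k []) j (List.replicate (n + m) true))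
      (2 * m + 1) := by
  have h := RunsIn.move hkj s
  rwa [hk, hj, List.reverse_replicate, List.replicate_append_replicate, List.length_replicate,
    Nat.add_comm m n] at h

/-- Push several symbols `true`. -/
def pushN (k : ℕ) : ℕ → Prog
  | 0 => skip
  | n + 1 => seq (push k true) (pushN k n)

theorem RunsIn.pushN (k n : ℕ) (s : Stacks) :
    RunsIn (pushN k n) s (update s k (List.replicate n true ++ s k)) (n + 1) := by
  induction n generalizing s with
  | zero => exact (RunsIn.skip s).congr (by simp)
  | succ n ih =>
    refine ((RunsIn.push k true s).seq (ih _)).mono (by omega) |>.congr ?_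
    rw [Function.update_idem, Function.update_self, List.replicate_succ']
    simp

/-- Copy a unary number from `k` to the empty stack `d`, using the empty stack `d + 1`. -/
def copy (k d : ℕ) : Prog :=
  seq (loop k (seq (push d true) (push (d + 1) true)) skip) (move (d + 1) k)

theorem RunsIn.copy {k d n : ℕ} {s : Stacks} (hk : k < d) (hs : s k = List.replicate n true)
    (hd : s d = []) (hd' : s (d + 1) = []) :
    RunsIn (copy k d) s (update s d (List.replicate n true)) (5 * n + 2) := by
  refine ((RunsIn.loop_unary (T := 2) n
    (fun i => update (update (update s d (List.replicate i true)) (d + 1)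
      (List.replicate i true)) k (List.replicate (n - i) true)) ?_ rfl ?_ fun i hi => ?_).seq
        (RunsIn.move (by omega) _)).mono ?_ |>.congr ?_
  · funext j
    grind [Function.update_apply]
  · simp
  · refine ((RunsIn.push _ _ _).seq (RunsIn.push _ _ _)).congr ?_
    funext j
    grind [Function.update_apply]
  · have : d + 1 ≠ k := by omega
    simp [this]
    omega
  · funext j
    grind [Function.update_apply, List.reverse_replicate]

end Prog

/-! ### Polynomially bounded functions -/

/-- Functions bounded by a power of `B + 2`. -/
def PolyLe (g : ℕ → ℕ) : Prop := ∃ C, ∀ B, g B ≤ (B + 2) ^ C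

namespace PolyLe

variable {f g : ℕ → ℕ}

theorem of_le (hg : PolyLe g) (h : ∀ B, f B ≤ g B) : PolyLe f :=
  let ⟨C, hC⟩ := hg
  ⟨C, fun B => (h B).trans (hC B)⟩

/-- The base `B + 2` is at least `2`, so constants and constant factors are absorbed by the
exponent. -/
theorem const (c : ℕ) : PolyLe fun _ => c :=
  ⟨c, fun B => Nat.lt_two_pow_self.le.trans (Nat.pow_le_pow_left (by omega) _)⟩

theorem id : PolyLe fun B => B := ⟨1, fun B => by rw [pow_one]; exact Nat.le_add_right B 2⟩

theorem add (hf : PolyLe f) (hg : PolyLe g) : PolyLe fun B => f B + g B := by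
  obtain ⟨C, hC⟩ := hf
  obtain ⟨D, hD⟩ := hg
  refine ⟨max C D + 1, fun B => ?_⟩
  have h₁ := (hC B).trans (Nat.pow_le_pow_right (by omega) (le_max_left C D))
  have h₂ := (hD B).trans (Nat.pow_le_pow_right (by omega) (le_max_right C D))
  rw [pow_succ]
  nlinarith [Nat.zero_le B]

theorem mul (hf : PolyLe f) (hg : PolyLe g) : PolyLe fun B => f B * g B := by
  obtain ⟨C, hC⟩ := hf
  obtain ⟨D, hD⟩ := hg
  exact ⟨C + D, fun B => (Nat.mul_le_mul (hC B) (hD B)).trans (pow_add _ _ _).ge⟩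

theorem pow (hf : PolyLe f) (n : ℕ) : PolyLe fun B => f B ^ n := by
  obtain ⟨C, hC⟩ := hf
  exact ⟨C * n, fun B => (Nat.pow_le_pow_left (hC B) n).trans (pow_mul _ _ _).ge⟩

theorem comp (hf : PolyLe f) (hg : PolyLe g) : PolyLe fun B => f (g B) := by
  obtain ⟨C, hC⟩ := hf
  exact (((hg.add (const 2)).pow C)).of_le fun B => hC _

end PolyLe

/-! ### Expressions for polynomial-time functions -/

/-- Numerical expressions that refer to a bit string. In `iter b i c e` the expression `e` may refer
to the current value as variable `0` and to the number of the iteration as variable `1`, in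
`lett a e` the expression `e` refers to the value of `a` as variable `0`. -/
inductive Expr
  | var (i : ℕ)
  | const (c : ℕ)
  | add (a b : Expr)
  | sub (a b : Expr)
  | mul (a b : Expr)
  | half (a : Expr)
  | bit (a : Expr)
  | len
  | iter (b i c e : Expr)
  | tab (f : ℕ → ℕ) (n : ℕ) (a : Expr)
  | lett (a e : Expr)

/-- Extend an assignment to the variables by a new variable `0`. -/
def scons {α : Type} (x : α) (env : ℕ → α) : ℕ → α
  | 0 => x
  | n + 1 => env n

namespace Expr

open Function (update)
open Prog

/-- The value of an expression. -/
def eval (w : List Bool) : Expr → (ℕ → ℕ) → ℕ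
  | var i, env => env i
  | const c, _ => c
  | add a b, env => a.eval w env + b.eval w env
  | sub a b, env => a.eval w env - b.eval w env
  | mul a b, env => a.eval w env * b.eval w env
  | half a, env => a.eval w env / 2
  | bit a, env => (w.getD (a.eval w env) false).toNat
  | len, _ => w.length
  | iter b i c e, env => Nat.rec (i.eval w env)
      (fun t r => min (c.eval w env) (e.eval w (scons r (scons t env)))) (b.eval w env)
  | tab f n a, env => if a.eval w env < n then f (a.eval w env) else 0
  | lett a e, env => e.eval w (scons (a.eval w env) env)

/-- Taking the minimum with the cap `c` in each round is what keeps values polynomial; iterated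
squaring without a cap would not be. -/
theorem iter_le {V i c : ℕ} {g : ℕ → ℕ → ℕ} (b : ℕ) (hi : i ≤ V) (hc : c ≤ V) :
    Nat.rec (motive := fun _ => ℕ) i (fun t r => min c (g t r)) b ≤ V := by
  cases b with
  | zero => exact hi
  | succ b => exact (min_le_left _ _).trans hc

theorem exists_eval_le (e : Expr) : ∃ V, PolyLe V ∧ ∀ w env B, w.length ≤ B → (∀ i, env i ≤ B) →
    e.eval w env ≤ V B := by
  induction e with
  | var i => exact ⟨_, .id, fun w env B _ h => h i⟩
  | const c => exact ⟨_, .const c, fun w env B _ h => le_rfl⟩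
  | add a b iha ihb =>
    obtain ⟨Va, ha, ha'⟩ := iha
    obtain ⟨Vb, hb, hb'⟩ := ihb
    exact ⟨_, ha.add hb, fun w env B hw h => Nat.add_le_add (ha' w env B hw h) (hb' w env B hw h)⟩
  | sub a b iha ihb =>
    obtain ⟨Va, ha, ha'⟩ := iha
    exact ⟨_, ha, fun w env B hw h => (Nat.sub_le _ _).trans (ha' w env B hw h)⟩
  | mul a b iha ihb =>
    obtain ⟨Va, ha, ha'⟩ := iha
    obtain ⟨Vb, hb, hb'⟩ := ihb
    exact ⟨_, ha.mul hb, fun w env B hw h => Nat.mul_le_mul (ha' w env B hw h) (hb' w env B hw h)⟩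
  | half a iha =>
    obtain ⟨Va, ha, ha'⟩ := iha
    exact ⟨_, ha, fun w env B hw h => (Nat.div_le_self _ _).trans (ha' w env B hw h)⟩
  | bit a iha => exact ⟨_, .const 1, fun w env B hw h => Bool.toNat_le _⟩
  | len => exact ⟨_, .id, fun w env B hw h => hw⟩
  | iter b i c e ihb ihi ihc ihe =>
    obtain ⟨Vi, hi, hi'⟩ := ihi
    obtain ⟨Vc, hc, hc'⟩ := ihc
    exact ⟨_, hi.add hc, fun w env B hw h => iter_le _
      ((hi' w env B hw h).trans (Nat.le_add_right _ _))
      ((hc' w env B hw h).trans (Nat.le_add_left _ _))⟩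
  | tab f n a iha =>
    refine ⟨_, .const ((Finset.range n).sup f), fun w env B hw h => ?_⟩
    simp only [eval]
    split_ifs with h
    · exact Finset.le_sup (Finset.mem_range.2 h)
    · exact Nat.zero_le _
  | lett a e iha ihe =>
    obtain ⟨Va, ha, ha'⟩ := iha
    obtain ⟨Ve, he, he'⟩ := ihe
    refine ⟨_, he.comp (PolyLe.id.add ha), fun w env B hw h =>
      he' w _ _ (hw.trans (Nat.le_add_right _ _)) ?_⟩
    rintro (_ | i)
    · exact (ha' w env B hw h).trans (Nat.le_add_left _ _)
    · exact (h i).trans (Nat.le_add_right _ _)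

/-- Look up the number on stack `k` in a table with `n` entries, adding the entry to stack `d`. -/
def tabProg (k d : ℕ) : (ℕ → ℕ) → ℕ → Prog
  | _, 0 => clear k
  | f, n + 1 => .pop k (pushN d (f 0)) (tabProg k d (fun i => f (i + 1)) n) .skip

/-- A program that computes an expression, writing the result to stack `d` and using stacks
after `d` as working space. The variable `i` is found on stack `ρ i`, the bit string on
stack `0`. -/
def compile : Expr → (ℕ → ℕ) → ℕ → Prog
  | var i, ρ, d => copy (ρ i) d
  | const c, _, d => pushN d c
  | add a b, ρ, d => .seq (a.compile ρ d) (.seq (b.compile ρ (d + 1)) (move (d + 1) d))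
  | sub a b, ρ, d => .seq (a.compile ρ d) (.seq (b.compile ρ (d + 1))
      (.loop (d + 1) (.pop d .skip .skip .skip) .skip))
  | mul a b, ρ, d => .seq (a.compile ρ (d + 1))
      (.loop (d + 1) (.seq (b.compile ρ (d + 2)) (move (d + 2) d)) .skip)
  | half a, ρ, d => .seq (a.compile ρ (d + 1))
      (.loop (d + 1) (.pop (d + 1) .skip (.push d true) .skip) .skip)
  | bit a, ρ, d => .seq (a.compile ρ (d + 1))
      (.seq (.loop (d + 1) (.pop 0 .skip (.push (d + 2) true) (.push (d + 2) false)) .skip)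
        (.seq (.pop 0 .skip (.seq (.push d true) (.push 0 true)) (.push 0 false))
          (move (d + 2) 0)))
  | len, _, d => .seq (.loop 0 (.seq (.push d true) (.push (d + 1) true))
      (.seq (.push d true) (.push (d + 1) false))) (move (d + 1) 0)
  | iter b i c e, ρ, d => .seq (i.compile ρ d) (.seq (b.compile ρ (d + 1)) (.seq
      (.loop (d + 1)
        (.seq (e.compile (scons d (scons (d + 2) ρ)) (d + 3)) (.seq (c.compile ρ (d + 4))
          (.seq (clear d) (.seq (.loop (d + 4) (.pop (d + 3) .skip (.push d true) .skip) .skip)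
            (.seq (clear (d + 3)) (.push (d + 2) true)))))) .skip)
      (clear (d + 2))))
  | tab f n a, ρ, d => .seq (a.compile ρ (d + 1)) (tabProg (d + 1) d f n)
  | lett a e, ρ, d => .seq (a.compile ρ d) (.seq (e.compile (scons d ρ) (d + 1))
      (.seq (clear d) (move (d + 1) d)))

/-- The stacks hold the input, the values of the variables, and empty working space from `d` on. -/
structure Ready (w : List Bool) (env ρ : ℕ → ℕ) (d : ℕ) (s : Stacks) : Prop where
  input : s 0 = w
  val : ∀ i, s (ρ i) = List.replicate (env i) true
  two_le : ∀ i, 2 ≤ ρ i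
  lt : ∀ i, ρ i < d
  empty : ∀ k, d ≤ k → s k = []

namespace Ready

variable {w : List Bool} {env ρ : ℕ → ℕ} {d d' : ℕ} {s : Stacks}

theorem two_lt (h : Ready w env ρ d s) : 2 < d := (h.two_le 0).trans_lt (h.lt 0)

theorem mono (h : Ready w env ρ d s) (hd : d ≤ d') : Ready w env ρ d' s :=
  ⟨h.input, h.val, h.two_le, fun i => (h.lt i).trans_le hd, fun k hk => h.empty k (hd.trans hk)⟩

theorem update (h : Ready w env ρ d s) {k : ℕ} (hk : d ≤ k) (hk' : k < d') (l : List Bool) :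
    Ready w env ρ d' (update s k l) := by
  have h2 := h.two_lt
  refine ⟨?_, fun i => ?_, h.two_le, fun i => (h.lt i).trans (by omega), fun j hj => ?_⟩
  · rw [Function.update_of_ne (by omega), h.input]
  · rw [Function.update_of_ne (by have := h.lt i; omega), h.val]
  · rw [Function.update_of_ne (by omega), h.empty j (by omega)]

theorem congr {s' : Stacks} (h : Ready w env ρ d s) (hd : d ≤ d') (h₁ : ∀ k < d, s' k = s k)
    (h₂ : ∀ k, d' ≤ k → s' k = []) : Ready w env ρ d' s' :=
  ⟨(h₁ _ (by have := h.two_lt; omega)).trans h.input, fun i => (h₁ _ (h.lt i)).trans (h.val i),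
    h.two_le, fun i => (h.lt i).trans_le hd, h₂⟩

theorem scons (h : Ready w env ρ d s) {k x : ℕ} (hk : s k = List.replicate x true) (h2 : 2 ≤ k)
    (hd : k < d) : Ready w (scons x env) (scons k ρ) d s := by
  refine ⟨h.input, ?_, ?_, ?_, h.empty⟩
  · rintro (_ | i)
    exacts [hk, h.val i]
  · rintro (_ | i)
    exacts [h2, h.two_le i]
  · rintro (_ | i)
    exacts [hd, h.lt i]

end Ready

/-- The compiled program is correct and takes time at most `T B`. -/
def Correct (e : Expr) (T : ℕ → ℕ) : Prop :=
  ∀ w env B ρ d s, w.length ≤ B → (∀ i, env i ≤ B) → Ready w env ρ d s →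
    (e.compile ρ d).RunsIn s (update s d (List.replicate (e.eval w env) true)) (T B)

/-- Each popped symbol moves on to the table shifted by one entry; when the stack runs empty the
first entry is the value sought. -/
theorem runsIn_tabProg {k d : ℕ} (hkd : k ≠ d) (f : ℕ → ℕ) (n v : ℕ) (s : Stacks)
    (hk : s k = List.replicate v true) (hd : s d = []) :
    (tabProg k d f n).RunsIn s (update (update s k []) d
      (List.replicate (if v < n then f v else 0) true)) (n + (Finset.range n).sup f + 2 * v + 1) := by
  induction n generalizing f v s with
  | zero =>
    refine ((RunsIn.clear k s).mono ?_).congr ?_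
    · simp [hk]
    · funext j
      grind [Function.update_apply]
  | succ n ih =>
    cases v with
    | zero =>
      refine ((RunsIn.pop_nil (by simpa using hk) (RunsIn.pushN d (f 0) s)).mono ?_).congr ?_
      · have : f 0 ≤ (Finset.range (n + 1)).sup f := Finset.le_sup (by simp)
        omega
      · funext j
        grind [Function.update_apply]
    | succ v =>
      refine ((RunsIn.pop_true (l := List.replicate v true) hk
        (ih (fun i => f (i + 1)) v _ (by simp) ?_)).mono ?_).congr ?_
      · rw [Function.update_of_ne hkd.symm, hd]
      · have : (Finset.range n).sup (fun i => f (i + 1)) ≤ (Finset.range (n + 1)).sup f :=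
          Finset.sup_le fun i hi => Finset.le_sup (f := f) (by simpa using hi)
        omega
      · funext j
        grind [Function.update_apply]

/-! ### Correctness and time bounds of compiled expressions. -/

theorem correct_var (i : ℕ) : Correct (var i) fun B => 5 * B + 2 := by
  intro w env B ρ d s hw henv h
  refine (RunsIn.copy (h.lt i) (h.val i) (h.empty d le_rfl) (h.empty _ (by omega))).mono ?_
  exact Nat.add_le_add_right (Nat.mul_le_mul_left _ (henv i)) _

theorem correct_const (c : ℕ) : Correct (const c) fun _ => c + 1 := by
  intro w env B ρ d s hw henv h
  refine (RunsIn.pushN d c s).congr ?_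
  rw [h.empty d le_rfl, List.append_nil]
  rfl

variable {a b c i e : Expr} {Ta Tb Tc Ti Te Va Vb Vc Vi Ve : ℕ → ℕ}

/-- The value of an expression is at most `V B`. -/
def EvalLe (e : Expr) (V : ℕ → ℕ) : Prop :=
  ∀ w env B, w.length ≤ B → (∀ i, env i ≤ B) → e.eval w env ≤ V B

theorem correct_add (ha : Correct a Ta) (hb : Correct b Tb) (hb' : EvalLe b Vb) :
    Correct (add a b) fun B => Ta B + (Tb B + (2 * Vb B + 1)) := by
  intro w env B ρ d s hw henv h
  refine ((ha w env B ρ d s hw henv h).seq ((hb w env B ρ (d + 1) _ hw henv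
    (h.update le_rfl (by omega) _)).seq ((RunsIn.move_unary (m := b.eval w env)
      (n := a.eval w env) (by omega) ?_ ?_).mono ?_))).congr ?_
  · simp
  · simp
  · have := hb' w env B hw henv
    omega
  · have := h.empty (d + 1) (by omega)
    funext j
    simp only [eval]
    grind [Function.update_apply]

theorem correct_sub (ha : Correct a Ta) (hb : Correct b Tb) (hb' : EvalLe b Vb) :
    Correct (sub a b) fun B => Ta B + (Tb B + (Vb B * 3 + 1)) := by
  intro w env B ρ d s hw henv h
  have hd := h.empty (d + 1) (by omega)
  refine (ha w env B ρ d s hw henv h).seq ((hb w env B ρ (d + 1) _ hw henv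
    (h.update le_rfl (by omega) _)).seq ((RunsIn.loop_unary (T := 2) (b.eval w env)
    (fun j => update (update s (d + 1) (List.replicate (b.eval w env - j) true)) d
      (List.replicate (a.eval w env - j) true)) ?_ ?_ ?_ fun j hj => ?_).mono ?_))
  · funext j
    grind [Function.update_apply]
  · funext j
    simp only [eval]
    grind [Function.update_apply]
  · simp
  · rcases Nat.eq_zero_or_pos (a.eval w env - j) with h0 | h0
    · refine (RunsIn.pop_nil ?_ (RunsIn.skip _)).congr ?_
      · simp [h0]
      · funext k
        grind [Function.update_apply]
    · refine (RunsIn.pop_true (l := List.replicate (a.eval w env - (j + 1)) true) ?_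
        (RunsIn.skip _)).congr ?_
      · have e : a.eval w env - j = (a.eval w env - (j + 1)) + 1 := by omega
        grind [Function.update_apply]
      · funext k
        grind [Function.update_apply]
  · have := hb' w env B hw henv
    omega

theorem correct_mul (ha : Correct a Ta) (ha' : EvalLe a Va) (hb : Correct b Tb)
    (hb' : EvalLe b Vb) :
    Correct (mul a b) fun B => Ta B + (Va B * (Tb B + (2 * Vb B + 1) + 1) + 1) := by
  intro w env B ρ d s hw henv h
  have hd := h.empty (d + 1) (by omega)
  have hd' := h.empty (d + 2) (by omega)
  have hd'' := h.empty d (by omega)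
  refine (ha w env B ρ (d + 1) s hw henv (h.mono (by omega))).seq
    ((RunsIn.loop_unary (T := Tb B + (2 * Vb B + 1)) (a.eval w env)
    (fun j => update (update s (d + 1) (List.replicate (a.eval w env - j) true)) d
      (List.replicate (j * b.eval w env) true)) ?_ ?_ ?_ fun j hj => ?_).mono ?_)
  · funext j
    grind [Function.update_apply]
  · funext j
    simp only [eval]
    grind [Function.update_apply]
  · simp
  · refine ((hb w env B ρ (d + 2) _ hw henv ?_).seq ((RunsIn.move_unary (m := b.eval w env)
      (n := j * b.eval w env) (by omega) ?_ ?_).mono ?_)).congr ?_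
    · refine h.congr (by omega) (fun k hk => ?_) fun k hk => ?_
      · grind [Function.update_apply]
      · have := h.empty k (by omega)
        grind [Function.update_apply]
    · simp
    · grind [Function.update_apply]
    · have := hb' w env B hw henv
      omega
    · funext k
      grind [Function.update_apply]
  · have := ha' w env B hw henv
    gcongr

/-- The loop pops one symbol and its body a second one; only a complete pair contributes to the
result. Hence the induction in steps of two. -/
theorem runsIn_half {k d v x : ℕ} (hkd : k ≠ d) {s : Stacks} (hk : s k = List.replicate v true)
    (hd : s d = List.replicate x true) :
    (loop k (.pop k .skip (.push d true) .skip) .skip).RunsIn s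
      (update (update s k []) d (List.replicate (x + v / 2) true)) (v * 3 + 1) := by
  induction v using Nat.twoStepInduction generalizing s x with
  | zero =>
    refine (RunsIn.loop_nil hk).congr ?_
    funext j
    grind [Function.update_apply]
  | one =>
    refine (RunsIn.loop_cons (a := true) (l := []) hk (RunsIn.pop_nil (by simp) (RunsIn.skip _))
      (RunsIn.loop_nil (by simp))).congr ?_
    funext j
    grind [Function.update_apply]
  | more v ih _ =>
    refine ((RunsIn.loop_cons (a := true) (l := List.replicate (v + 1) true) hk
      (RunsIn.pop_true (l := List.replicate v true) (by simp [List.replicate_succ])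
        (RunsIn.push _ _ _)) (ih (x := x + 1) ?_ ?_)).mono ?_).congr ?_
    · grind [Function.update_apply]
    · grind [Function.update_apply]
    · omega
    · have : x + 1 + v / 2 = x + (v + 2) / 2 := by omega
      funext j
      grind [Function.update_apply]

theorem correct_half (ha : Correct a Ta) (ha' : EvalLe a Va) :
    Correct (half a) fun B => Ta B + (Va B * 3 + 1) := by
  intro w env B ρ d s hw henv h
  have hd := h.empty d le_rfl
  refine ((ha w env B ρ (d + 1) s hw henv (h.mono (by omega))).seq
    ((runsIn_half (v := a.eval w env) (x := 0) (by omega) ?_ ?_).mono ?_)).congr ?_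
  · simp
  · simp [hd]
  · have := ha' w env B hw henv
    omega
  · have := h.empty (d + 1) (by omega)
    funext j
    simp only [eval]
    grind [Function.update_apply]

theorem correct_bit (ha : Correct a Ta) (ha' : EvalLe a Va) :
    Correct (bit a) fun B => Ta B + ((Va B * 3 + 1) + (3 + (2 * B + 1))) := by
  intro w env B ρ d s hw henv h
  have hd := h.empty d le_rfl
  have hd₁ := h.empty (d + 1) (by omega)
  have hd₂ := h.empty (d + 2) (by omega)
  have h2 := h.two_lt
  have h0 := h.input
  set v := a.eval w env with hv
  -- The first `v` input bits are parked on stack `d + 2`, which brings bit `v` to the top of stack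
  -- `0`; they are put back at the end.
  have hloop : (loop (d + 1) (.pop 0 .skip (.push (d + 2) true) (.push (d + 2) false))
      .skip).RunsIn (update s (d + 1) (List.replicate v true))
      (update (update s 0 (w.drop v)) (d + 2) (w.take v).reverse) (v * 3 + 1) := by
    refine RunsIn.loop_unary (T := 2) v (fun j => update (update (update s (d + 1)
      (List.replicate (v - j) true)) 0 (w.drop j)) (d + 2) (w.take j).reverse) ?_ ?_ ?_
      fun j hj => ?_
    · funext k
      grind [Function.update_apply]
    · funext k
      grind [Function.update_apply]
    · intro j hj
      grind [Function.update_apply]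
    · rcases lt_or_ge j w.length with hlt | hge
      · have hdrop := List.drop_eq_getElem_cons hlt
        have htake : (w.take (j + 1)).reverse = w[j] :: (w.take j).reverse := by
          rw [List.take_succ_eq_append_getElem hlt, List.reverse_append]
          rfl
        cases hx : w[j] with
        | true =>
          refine (RunsIn.pop_true (l := w.drop (j + 1)) ?_ (RunsIn.push _ _ _)).congr ?_
          · grind [Function.update_apply]
          · funext k
            grind [Function.update_apply]
        | false =>
          refine (RunsIn.pop_false (l := w.drop (j + 1)) ?_ (RunsIn.push _ _ _)).congr ?_
          · grind [Function.update_apply]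
          · funext k
            grind [Function.update_apply]
      -- Beyond the end of the input the pop finds nothing and the state no longer changes, in
      -- accordance with the default `false` of `getD`.
      · have e₁ : w.drop j = [] := List.drop_eq_nil_of_le hge
        have e₂ : w.drop (j + 1) = [] := List.drop_eq_nil_of_le (by omega)
        have e₃ : w.take j = w := List.take_of_length_le hge
        have e₄ : w.take (j + 1) = w := List.take_of_length_le (by omega)
        refine (RunsIn.pop_nil ?_ (RunsIn.skip _)).congr ?_
        · grind [Function.update_apply]
        · funext k
          grind [Function.update_apply]
  have hpop : (pop 0 .skip (.seq (.push d true) (.push 0 true)) (.push 0 false)).RunsIn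
      (update (update s 0 (w.drop v)) (d + 2) (w.take v).reverse)
      (update (update (update s 0 (w.drop v)) (d + 2) (w.take v).reverse) d
        (List.replicate (w.getD v false).toNat true)) 3 := by
    rcases lt_or_ge v w.length with hlt | hge
    · have hdrop := List.drop_eq_getElem_cons hlt
      have hget : w.getD v false = w[v] := by simp [hlt]
      cases hx : w[v] with
      | true =>
        refine (RunsIn.pop_true (l := w.drop (v + 1)) ?_
          ((RunsIn.push _ _ _).seq (RunsIn.push _ _ _))).congr ?_
        · grind [Function.update_apply]
        · rw [hget, hx]
          funext k
          grind [Function.update_apply]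
      | false =>
        refine ((RunsIn.pop_false (l := w.drop (v + 1)) ?_
          (RunsIn.push _ _ _)).mono (by omega)).congr ?_
        · grind [Function.update_apply]
        · rw [hget, hx]
          funext k
          grind [Function.update_apply]
    · have e₁ : w.drop v = [] := List.drop_eq_nil_of_le hge
      have hget : w.getD v false = false := by simp [hge]
      refine ((RunsIn.pop_nil ?_ (RunsIn.skip _)).mono (by omega)).congr ?_
      · grind [Function.update_apply]
      · rw [hget]
        funext k
        grind [Function.update_apply]
  refine (ha w env B ρ (d + 1) s hw henv (h.mono (by omega))).seq ((hloop.mono ?_).seq (hpop.seq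
    (((RunsIn.move (by omega) _).mono ?_).congr ?_)))
  · have := ha' w env B hw henv
    omega
  · have : min v w.length ≤ B := (min_le_right _ _).trans hw
    simpa [Function.update_apply] using this
  · have := List.take_append_drop v w
    funext k
    simp only [eval]
    grind [Function.update_apply]

theorem runsIn_len {d n : ℕ} (h2 : 2 < d) (l m : List Bool) {s : Stacks} (h0 : s 0 = l)
    (hd : s d = List.replicate n true) (hm : s (d + 1) = m) :
    (loop 0 (.seq (.push d true) (.push (d + 1) true))
      (.seq (.push d true) (.push (d + 1) false))).RunsIn s
      (update (update (update s 0 []) d (List.replicate (n + l.length) true)) (d + 1)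
        (l.reverse ++ m)) (l.length * 3 + 1) := by
  induction l generalizing s n m with
  | nil =>
    refine (RunsIn.loop_nil h0).congr ?_
    funext j
    grind [Function.update_apply]
  | cons a l ih =>
    refine ((RunsIn.loop_cons (T := 2) (s₁ := update (update (update s 0 l) d
      (List.replicate (n + 1) true)) (d + 1) (a :: m)) h0 ?_
      (ih (n := n + 1) (a :: m) ?_ ?_ ?_)).mono ?_).congr ?_
    · cases a <;>
      · refine ((RunsIn.push _ _ _).seq (RunsIn.push _ _ _)).congr ?_
        funext j
        grind [Function.update_apply]
    · grind [Function.update_apply]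
    · grind [Function.update_apply]
    · grind [Function.update_apply]
    · simp
      omega
    · have : n + 1 + l.length = n + (l.length + 1) := by omega
      funext j
      grind [Function.update_apply]

theorem correct_len : Correct len fun B => B * 3 + 1 + (2 * B + 1) := by
  intro w env B ρ d s hw henv h
  have h2 := h.two_lt
  have hd := h.empty d le_rfl
  have hd₁ := h.empty (d + 1) (by omega)
  have h0 := h.input
  refine ((runsIn_len (n := 0) h2 w [] h.input (by simpa using hd) hd₁).mono ?_).seq
    (((RunsIn.move (by omega) _).mono ?_).congr ?_)
  · omega
  · simpa [Function.update_apply] using hw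
  · funext j
    simp only [eval]
    grind [Function.update_apply]

theorem correct_tab (ha : Correct a Ta) (ha' : EvalLe a Va) (f : ℕ → ℕ) (n : ℕ) :
    Correct (tab f n a) fun B => Ta B + (n + (Finset.range n).sup f + 2 * Va B + 1) := by
  intro w env B ρ d s hw henv h
  have hd := h.empty d le_rfl
  have hd₁ := h.empty (d + 1) (by omega)
  refine ((ha w env B ρ (d + 1) s hw henv (h.mono (by omega))).seq
    ((runsIn_tabProg (by omega) f n (a.eval w env) _ ?_ ?_).mono ?_)).congr ?_
  · simp
  · grind [Function.update_apply]
  · have := ha' w env B hw henv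
    omega
  · funext j
    simp only [eval]
    grind [Function.update_apply]

theorem correct_lett (ha : Correct a Ta) (ha' : EvalLe a Va) (he : Correct e Te)
    (he' : EvalLe e Ve) : Correct (lett a e) fun B =>
      Ta B + (Te (B + Va B) + ((2 * Va B + 1) + (2 * Ve (B + Va B) + 1))) := by
  intro w env B ρ d s hw henv h
  have hd := h.empty d le_rfl
  have hd₁ := h.empty (d + 1) (by omega)
  have hva := ha' w env B hw henv
  have henv' : ∀ i, scons (a.eval w env) env i ≤ B + Va B := by
    rintro (_ | i)
    · exact hva.trans (Nat.le_add_left _ _)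
    · exact (henv i).trans (Nat.le_add_right _ _)
  have hve := he' w _ _ (hw.trans (Nat.le_add_right _ _)) henv'
  refine (ha w env B ρ d s hw henv h).seq ((he w _ _ (scons d ρ) (d + 1) _
    (hw.trans (Nat.le_add_right _ _)) henv' ?_).seq (((RunsIn.clear _ _).mono ?_).seq
    (((RunsIn.move_unary (m := e.eval w (scons (a.eval w env) env)) (n := 0)
      (by omega) ?_ ?_).mono ?_).congr ?_)))
  · exact (h.update le_rfl (by omega) _).scons (by simp) h.two_lt.le (by omega)
  · simpa [Function.update_apply] using hva
  · grind [Function.update_apply]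
  · grind [Function.update_apply]
  · omega
  · funext j
    simp only [eval]
    grind [Function.update_apply]

/-- Stack `d` holds the current value, `d + 1` the rounds left, `d + 2` the number of the round, `d
+ 3` the new value and `d + 4` the cap. Thanks to the cap all variables seen by the body stay below
`B + Vb B + (Vi B + Vc B)`, so one time bound serves all rounds. -/
theorem correct_iter (hb : Correct b Tb) (hb' : EvalLe b Vb) (hi : Correct i Ti)
    (hi' : EvalLe i Vi) (hc : Correct c Tc) (hc' : EvalLe c Vc) (he : Correct e Te)
    (he' : EvalLe e Ve) : Correct (iter b i c e) fun B =>
      Ti B + (Tb B + ((Vb B * (Te (B + Vb B + (Vi B + Vc B)) + (Tc B + ((2 * (Vi B + Vc B) + 1) +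
        ((Vc B * 3 + 1) + ((2 * Ve (B + Vb B + (Vi B + Vc B)) + 1) + 1)))) + 1) + 1) +
        (2 * Vb B + 1))) := by
  intro w env B ρ d s hw henv h
  have hd := h.empty d le_rfl
  have hd₁ := h.empty (d + 1) (by omega)
  have hd₂ := h.empty (d + 2) (by omega)
  have hd₃ := h.empty (d + 3) (by omega)
  have hd₄ := h.empty (d + 4) (by omega)
  have h2 := h.two_lt
  have hvb := hb' w env B hw henv
  have hvi := hi' w env B hw henv
  have hvc := hc' w env B hw henv
  set n := b.eval w env with hn
  set B' := B + Vb B + (Vi B + Vc B) with hB'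
  obtain ⟨R, hR₀, hRs, hRn, hRle⟩ : ∃ R : ℕ → ℕ, R 0 = i.eval w env ∧
      (∀ t, R (t + 1) = min (c.eval w env) (e.eval w (scons (R t) (scons t env)))) ∧
      R n = (iter b i c e).eval w env ∧ ∀ t, R t ≤ Vi B + Vc B :=
    ⟨fun t => Nat.rec (i.eval w env)
      (fun t r => min (c.eval w env) (e.eval w (scons r (scons t env)))) t, rfl, fun t => rfl, rfl,
      fun t => iter_le t (hvi.trans (Nat.le_add_right _ _))
        (hvc.trans (Nat.le_add_left _ _))⟩
  have henv' : ∀ t ≤ n, ∀ j, scons (R t) (scons t env) j ≤ B' := by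
    rintro t ht (_ | _ | j)
    · exact (hRle t).trans (Nat.le_add_left _ _)
    · change t ≤ B'
      omega
    · exact (henv j).trans (by omega)
  have hve : ∀ t ≤ n, e.eval w (scons (R t) (scons t env)) ≤ Ve B' := fun t ht =>
    he' w _ _ (hw.trans (by omega)) (henv' t ht)
  let st : ℕ → Stacks := fun t => update (update (update s (d + 1) (List.replicate (n - t) true))
    (d + 2) (List.replicate t true)) d (List.replicate (R t) true)
  refine (hi w env B ρ d s hw henv h).seq ((hb w env B ρ (d + 1) _ hw henv
    (h.update le_rfl (by omega) _)).seq (((RunsIn.loop_unary (T := Te B' + (Tc B +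
      ((2 * (Vi B + Vc B) + 1) + ((Vc B * 3 + 1) + ((2 * Ve B' + 1) + 1))))) n st ?_ rfl ?_
      fun t ht => ?_).mono ?_).seq (((RunsIn.clear _ _).mono ?_).congr ?_)))
  · funext k
    grind [Function.update_apply]
  · intro t ht
    grind [Function.update_apply]
  · set s₀ : Stacks := update (st t) (d + 1) (List.replicate (n - t - 1) true) with hs₀
    set x := e.eval w (scons (R t) (scons t env)) with hx
    set y := c.eval w env with hy
    have hready : Ready w env ρ (d + 3) s₀ := by
      refine h.congr (by omega) (fun k hk => ?_) fun k hk => ?_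
      · grind [Function.update_apply]
      · have := h.empty k (by omega)
        grind [Function.update_apply]
    have hready' : Ready w (scons (R t) (scons t env)) (scons d (scons (d + 2) ρ)) (d + 3) s₀ := by
      refine (hready.scons (k := d + 2) ?_ (by omega) (by omega)).scons (k := d) ?_ (by omega)
        (by omega)
      · grind [Function.update_apply]
      · grind [Function.update_apply]
    have hRt : R (t + 1) = min y x := hRs t
    -- The minimum of value and cap arises by popping both together: after `j` rounds of the inner
    -- loop, `min j x` symbols have reached stack `d`.
    refine (he w _ B' _ (d + 3) s₀ (hw.trans (by omega)) (henv' t (by omega)) hready').seq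
      ((hc w env B ρ (d + 4) _ hw henv (hready.update le_rfl (by omega) _)).seq
      (((RunsIn.clear _ _).mono ?_).seq (((RunsIn.loop_unary (T := 2) y
        (fun j => update (update (update (update s₀ d []) (d + 3) (List.replicate (x - j) true))
          (d + 4) (List.replicate (y - j) true)) d (List.replicate (min j x) true))
        ?_ rfl ?_ fun j hj => ?_).mono ?_).seq (((RunsIn.clear _ _).mono ?_).seq
        ((RunsIn.push _ _ _).congr ?_)))))
    · have := hRle t
      grind [Function.update_apply]
    · funext k
      grind [Function.update_apply]
    · intro j hj
      grind [Function.update_apply]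
    · rcases Nat.eq_zero_or_pos (x - j) with h0 | h0
      · refine (RunsIn.pop_nil ?_ (RunsIn.skip _)).congr ?_
        · grind [Function.update_apply]
        · have e₁ : min (j + 1) x = min j x := by omega
          have e₂ : x - (j + 1) = x - j := by omega
          funext k
          grind [Function.update_apply]
      · have e₁ : min (j + 1) x = min j x + 1 := by omega
        have e₂ : x - j = x - (j + 1) + 1 := by omega
        refine (RunsIn.pop_true (l := List.replicate (x - (j + 1)) true) ?_
          (RunsIn.push _ _ _)).congr ?_
        · grind [Function.update_apply]
        · funext k
          grind [Function.update_apply]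
    · omega
    · have := hve t (by omega)
      grind [Function.update_apply]
    · clear hRs hve henv' hRle hready hready' henv
      clear_value x y n
      funext k
      by_cases h₁ : k = d + 3
      · grind [Function.update_apply]
      by_cases h₂ : k = d + 4
      · grind [Function.update_apply]
      by_cases h₃ : k = d + 2
      · grind [Function.update_apply]
      by_cases h₄ : k = d
      · grind [Function.update_apply]
      simp only [s₀, st, Function.update_of_ne, ne_eq, h₁, h₂, h₃, h₄, not_false_eq_true]
      grind [Function.update_apply]
  · gcongr
  · grind [Function.update_apply]
  · funext k
    grind [Function.update_apply]

end Expr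

/-! ### Expressions are computable in polynomial time. -/

namespace Expr

theorem exists_correct (e : Expr) : ∃ T, PolyLe T ∧ e.Correct T := by
  have bd : ∀ e : Expr, ∃ V, PolyLe V ∧ e.EvalLe V := exists_eval_le
  have c := PolyLe.const
  induction e with
  | var i => exact ⟨_, ((c 5).mul .id).add (c 2), correct_var i⟩
  | const n => exact ⟨_, c (n + 1), correct_const n⟩
  | add a b iha ihb =>
    obtain ⟨Ta, ha, ha'⟩ := iha
    obtain ⟨Tb, hb, hb'⟩ := ihb
    obtain ⟨Vb, hv, hv'⟩ := bd b
    exact ⟨_, ha.add (hb.add (((c 2).mul hv).add (c 1))), correct_add ha' hb' hv'⟩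
  | sub a b iha ihb =>
    obtain ⟨Ta, ha, ha'⟩ := iha
    obtain ⟨Tb, hb, hb'⟩ := ihb
    obtain ⟨Vb, hv, hv'⟩ := bd b
    exact ⟨_, ha.add (hb.add ((hv.mul (c 3)).add (c 1))), correct_sub ha' hb' hv'⟩
  | mul a b iha ihb =>
    obtain ⟨Ta, ha, ha'⟩ := iha
    obtain ⟨Tb, hb, hb'⟩ := ihb
    obtain ⟨Va, hu, hu'⟩ := bd a
    obtain ⟨Vb, hv, hv'⟩ := bd b
    exact ⟨_, ha.add ((hu.mul ((hb.add (((c 2).mul hv).add (c 1))).add (c 1))).add (c 1)),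
      correct_mul ha' hu' hb' hv'⟩
  | half a iha =>
    obtain ⟨Ta, ha, ha'⟩ := iha
    obtain ⟨Va, hv, hv'⟩ := bd a
    exact ⟨_, ha.add ((hv.mul (c 3)).add (c 1)), correct_half ha' hv'⟩
  | bit a iha =>
    obtain ⟨Ta, ha, ha'⟩ := iha
    obtain ⟨Va, hv, hv'⟩ := bd a
    exact ⟨_, ha.add (((hv.mul (c 3)).add (c 1)).add ((c 3).add (((c 2).mul .id).add (c 1)))),
      correct_bit ha' hv'⟩
  | len => exact ⟨_, ((PolyLe.id.mul (c 3)).add (c 1)).add (((c 2).mul .id).add (c 1)), correct_len⟩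
  | iter b i k e ihb ihi ihc ihe =>
    obtain ⟨Tb, hb, hb'⟩ := ihb
    obtain ⟨Ti, hi, hi'⟩ := ihi
    obtain ⟨Tc, hc, hc'⟩ := ihc
    obtain ⟨Te, he, he'⟩ := ihe
    obtain ⟨Vb, hvb, hvb'⟩ := bd b
    obtain ⟨Vi, hvi, hvi'⟩ := bd i
    obtain ⟨Vc, hvc, hvc'⟩ := bd k
    obtain ⟨Ve, hve, hve'⟩ := bd e
    have hB := (PolyLe.id.add hvb).add (hvi.add hvc)
    exact ⟨_, hi.add (hb.add (((hvb.mul (((he.comp hB).add (hc.add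
      ((((c 2).mul (hvi.add hvc)).add (c 1)).add (((hvc.mul (c 3)).add (c 1)).add
        ((((c 2).mul (hve.comp hB)).add (c 1)).add (c 1)))))).add (c 1))).add (c 1)).add
        (((c 2).mul hvb).add (c 1)))), correct_iter hb' hvb' hi' hvi' hc' hvc' he' hve'⟩
  | tab f n a iha =>
    obtain ⟨Ta, ha, ha'⟩ := iha
    obtain ⟨Va, hv, hv'⟩ := bd a
    exact ⟨_, ha.add (((c (n + (Finset.range n).sup f)).add ((c 2).mul hv)).add (c 1)),
      correct_tab ha' hv' f n⟩
  | lett a e iha ihe =>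
    obtain ⟨Ta, ha, ha'⟩ := iha
    obtain ⟨Te, he, he'⟩ := ihe
    obtain ⟨Va, hv, hv'⟩ := bd a
    obtain ⟨Ve, hu, hu'⟩ := bd e
    have hB := PolyLe.id.add hv
    exact ⟨_, ha.add ((he.comp hB).add ((((c 2).mul hv).add (c 1)).add
      (((c 2).mul (hu.comp hB)).add (c 1)))), correct_lett ha' hv' he' hu'⟩

end Expr

/-! ### Programs that output bit strings -/

/-- Descriptions of bit strings: a bit that tells whether an expression is nonzero, concatenation,
and repetition, where the number of the iteration is available as variable `0`. -/
inductive Out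
  | bit (e : Expr)
  | seq (o₁ o₂ : Out)
  | rep (b : Expr) (o : Out)

namespace Out

open Function (update)
open Prog

/-- The bit string described. -/
def emit (w : List Bool) : Out → (ℕ → ℕ) → List Bool
  | bit e, env => [decide (e.eval w env ≠ 0)]
  | seq o₁ o₂, env => o₁.emit w env ++ o₂.emit w env
  | rep b o, env => (List.range (b.eval w env)).flatMap fun t => o.emit w (scons t env)

/-- A program that appends the bit string to stack `1`. -/
def compile : Out → (ℕ → ℕ) → ℕ → Prog
  | bit e, ρ, d => .seq (e.compile ρ d) (.pop d (.push 1 false)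
      (.seq (.push 1 true) (clear d)) .skip)
  | seq o₁ o₂, ρ, d => .seq (o₁.compile ρ d) (o₂.compile ρ d)
  | rep b o, ρ, d => .seq (b.compile ρ d) (.seq
      (.loop d (.seq (o.compile (scons (d + 1) ρ) (d + 2)) (.push (d + 1) true)) .skip)
      (clear (d + 1)))

/-- The compiled program is correct and takes time at most `T B`. -/
def Correct (o : Out) (T : ℕ → ℕ) : Prop :=
  ∀ w env B ρ d s, w.length ≤ B → (∀ i, env i ≤ B) → Expr.Ready w env ρ d s →
    (o.compile ρ d).RunsIn s (update s 1 ((o.emit w env).reverse ++ s 1)) (T B)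

/-- The length matters because handing the output over to the next machine takes one step per
symbol. -/
theorem exists_length_emit_le (o : Out) : ∃ V, PolyLe V ∧ ∀ w env B, w.length ≤ B →
    (∀ i, env i ≤ B) → (o.emit w env).length ≤ V B := by
  induction o with
  | bit e => exact ⟨_, .const 1, fun w env B _ _ => le_rfl⟩
  | seq o₁ o₂ ih₁ ih₂ =>
    obtain ⟨V₁, h₁, h₁'⟩ := ih₁
    obtain ⟨V₂, h₂, h₂'⟩ := ih₂
    refine ⟨_, h₁.add h₂, fun w env B hw h => ?_⟩
    rw [emit, List.length_append]
    exact Nat.add_le_add (h₁' w env B hw h) (h₂' w env B hw h)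
  | rep b o ih =>
    obtain ⟨V, h, h'⟩ := ih
    obtain ⟨Vb, hb, hb'⟩ := b.exists_eval_le
    refine ⟨_, hb.mul (h.comp (PolyLe.id.add hb)), fun w env B hw henv => ?_⟩
    have hvb := hb' w env B hw henv
    rw [emit, List.length_flatMap]
    refine (List.sum_le_card_nsmul _ (V (B + Vb B)) fun x hx => ?_).trans ?_
    · obtain ⟨t, ht, rfl⟩ := List.mem_map.1 hx
      refine h' w _ _ (hw.trans (Nat.le_add_right _ _)) ?_
      rintro (_ | i)
      · have := List.mem_range.1 ht
        change t ≤ _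
        omega
      · exact (henv i).trans (Nat.le_add_right _ _)
    · rw [List.length_map, List.length_range, smul_eq_mul]
      exact Nat.mul_le_mul_right _ hvb

theorem correct_bit {e : Expr} {T V : ℕ → ℕ} (he : e.Correct T) (he' : e.EvalLe V) :
    Correct (bit e) fun B => T B + (1 + (2 * V B + 1) + 1) := by
  intro w env B ρ d s hw henv h
  have h2 := h.two_lt
  have hd := h.empty d le_rfl
  have hv := he' w env B hw henv
  refine (he w env B ρ d s hw henv h).seq ?_
  rcases hx : e.eval w env with _ | n
  · refine ((RunsIn.pop_nil ?_ (RunsIn.push _ _ _)).mono (by omega)).congr ?_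
    · simp
    · funext j
      simp only [emit, hx]
      grind [Function.update_apply]
  · refine ((RunsIn.pop_true (l := List.replicate n true) ?_ ((RunsIn.push _ _ _).seq
      ((RunsIn.clear _ _).mono (T' := 2 * V B + 1) ?_))).mono (by omega)).congr ?_
    · simp [List.replicate_succ]
    · grind [Function.update_apply]
    · funext j
      simp only [emit, hx]
      grind [Function.update_apply]

theorem correct_rep {b : Expr} {o : Out} {T Tb Vb : ℕ → ℕ} (hb : b.Correct Tb)
    (hb' : b.EvalLe Vb) (ho : o.Correct T) : Correct (rep b o) fun B =>
      Tb B + ((Vb B * (T (B + Vb B) + 1 + 1) + 1) + (2 * Vb B + 1)) := by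
  intro w env B ρ d s hw henv h
  have h2 := h.two_lt
  have hd := h.empty d le_rfl
  have hd₁ := h.empty (d + 1) (by omega)
  have hv := hb' w env B hw henv
  refine (hb w env B ρ d s hw henv h).seq ?_
  rw [emit]
  generalize b.eval w env = n at hv ⊢
  obtain ⟨L, hL⟩ : ∃ L : ℕ → List Bool, ∀ t,
      L t = (List.range t).flatMap fun t => o.emit w (scons t env) := ⟨_, fun t => rfl⟩
  have hL₀ : L 0 = [] := hL 0
  have hLs : ∀ t, (L (t + 1)).reverse = (o.emit w (scons t env)).reverse ++ (L t).reverse := by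
    intro t
    rw [hL, hL, List.range_succ, List.flatMap_append, List.reverse_append]
    simp
  rw [← hL]
  clear hL
  refine ((RunsIn.loop_unary (T := T (B + Vb B) + 1) n (fun t => update (update (update s d (List.replicate (n - t) true))
    (d + 1) (List.replicate t true)) 1 ((L t).reverse ++ s 1)) ?_ rfl ?_ fun t ht => ?_).mono
    ?_).seq (((RunsIn.clear _ _).mono ?_).congr ?_)
  · funext j
    grind [Function.update_apply]
  · intro t ht
    grind [Function.update_apply]
  · have hr : Expr.Ready w (scons t env) (scons (d + 1) ρ) (d + 2)
        (update (update (update (update s d (List.replicate (n - t) true))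
          (d + 1) (List.replicate t true)) 1 ((L t).reverse ++ s 1)) d
          (List.replicate (n - t - 1) true)) := by
      clear hLs
      refine Expr.Ready.scons ⟨?_, fun i => ?_, h.two_le, fun i => ?_, fun k hk => ?_⟩ ?_
        (by omega) (by omega)
      · rw [← h.input]
        grind [Function.update_apply]
      · rw [← h.val]
        have := h.two_le i
        have := h.lt i
        grind [Function.update_apply]
      · have := h.lt i
        omega
      · have := h.empty k (by omega)
        grind [Function.update_apply]
      · grind [Function.update_apply]
    refine ((ho w _ (B + Vb B) _ _ _ (hw.trans (Nat.le_add_right _ _)) ?_ hr).seq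
      (RunsIn.push _ _ _)).congr ?_
    · rintro (_ | i)
      · change t ≤ _
        omega
      · exact (henv i).trans (Nat.le_add_right _ _)
    · have := hLs t
      clear hLs hr
      funext j
      grind [Function.update_apply]
  · gcongr
  · grind [Function.update_apply]
  · funext j
    grind [Function.update_apply]

theorem exists_correct (o : Out) : ∃ T, PolyLe T ∧ o.Correct T := by
  have c := PolyLe.const
  induction o with
  | bit e =>
    obtain ⟨T, he, he'⟩ := e.exists_correct
    obtain ⟨V, hv, hv'⟩ := e.exists_eval_le
    exact ⟨_, he.add (((c 1).add (((c 2).mul hv).add (c 1))).add (c 1)), correct_bit he' hv'⟩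
  | seq o₁ o₂ ih₁ ih₂ =>
    obtain ⟨T₁, h₁, h₁'⟩ := ih₁
    obtain ⟨T₂, h₂, h₂'⟩ := ih₂
    refine ⟨_, h₁.add h₂, fun w env B ρ d s hw henv h => ?_⟩
    refine ((h₁' w env B ρ d s hw henv h).seq (h₂' w env B ρ d _ hw henv ?_)).congr ?_
    · refine ⟨?_, fun i => ?_, h.two_le, h.lt, fun k hk => ?_⟩
      · rw [Function.update_of_ne (by omega), h.input]
      · rw [Function.update_of_ne (by have := h.two_le i; omega), h.val]
      · rw [Function.update_of_ne (by have := h.two_lt; omega), h.empty k hk]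
    · simp [emit]
  | rep b o ih =>
    obtain ⟨T, h, h'⟩ := ih
    obtain ⟨Tb, hb, hb'⟩ := b.exists_correct
    obtain ⟨V, hv, hv'⟩ := b.exists_eval_le
    exact ⟨_, hb.add (((hv.mul (((h.comp (PolyLe.id.add hv)).add (c 1)).add (c 1))).add (c 1)).add
      (((c 2).mul hv).add (c 1))), correct_rep hb' hv' h'⟩

end Out

/-- The form of the reduction principle that is applied below: once the reduction is written as an
`Out`, only an additive polynomial in the input length is lost. -/
theorem DecidesInTime.of_out {α β : Type} {encα : α → List Bool} {encβ : β → List Bool}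
    {p : α → Prop} {q : β → Prop} {T : β → ℝ} (hq : DecidesInTime encβ q T) (r : α → β)
    (hr : ∀ a, q (r a) ↔ p a) (o : Out) (ho : ∀ a, o.emit (encα a) (fun _ => 0) = encβ (r a)) :
    ∃ C : ℕ, DecidesInTime encα p fun a => (((encα a).length + 2 : ℕ) : ℝ) ^ C + T (r a) := by
  obtain ⟨T₁, h₁, h₁'⟩ := o.exists_correct
  obtain ⟨V, hV, hV'⟩ := o.exists_length_emit_le
  obtain ⟨C, hC⟩ := ((h₁.add (((PolyLe.const 2).mul .id).add (.const 1))).add hV).add (.const 1)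
  refine ⟨C, ?_⟩
  -- All variables are read from the empty stack `2`, that is, they are `0`; working space starts at
  -- stack `3`. The input is erased at the end, since only stack `1` may be left nonempty.
  obtain ⟨M, hΓ, hM⟩ := hq.of_prog r hr (.seq (o.compile (fun _ => 2) 3) (Prog.clear 0))
    (fun a => T₁ (encα a).length + (2 * (encα a).length + 1)) fun a => by
      refine ((h₁' (encα a) (fun _ => 0) _ (fun _ => 2) 3
        (Function.update (fun _ => []) 0 (encα a)) le_rfl (fun _ => Nat.zero_le _) ?_).seq
        ((Prog.RunsIn.clear 0 _).mono ?_)).congr ?_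
      · refine ⟨?_, fun i => ?_, fun i => le_rfl, fun i => by norm_num, fun k hk => ?_⟩
        · simp
        · simp
        · rw [Function.update_of_ne (by omega)]
      · simp
      · rw [ho]
        funext j
        grind [Function.update_apply]
  refine ⟨M, hΓ, fun a => ?_⟩
  obtain ⟨b, t, hb, ht, h⟩ := hM a
  refine ⟨b, t, hb, ht.trans ?_, h⟩
  have h₂ := hV' (encα a) (fun _ => 0) _ le_rfl fun _ => Nat.zero_le _
  rw [ho] at h₂
  have h₃ : T₁ (encα a).length + (2 * (encα a).length + 1) + V (encα a).length + 1
      ≤ ((encα a).length + 2) ^ C := hC (encα a).length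
  have h₄ : T₁ (encα a).length + (2 * (encα a).length + 1) + (encβ (r a)).length + 1
      ≤ ((encα a).length + 2) ^ C := by
    omega
  have h₅ : ((T₁ (encα a).length + (2 * (encα a).length + 1) + (encβ (r a)).length + 1 : ℕ) : ℝ)
      ≤ (((encα a).length + 2) ^ C : ℕ) := by
    exact_mod_cast h₄
  push_cast at h₅ ⊢
  linarith

/-! ### Reading the code of a formula -/

namespace CNFCode

open Expr

/-- The bit at position `p`, as a number. -/
def bitN (w : List Bool) (p : ℕ) : ℕ := (w.getD p false).toNat

/-- The number of successive symbols `true` from position `q` on. -/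
def run (w : List Bool) (q : ℕ) : ℕ :=
  Nat.rec 0 (fun _ r => min w.length (r + bitN w (q + r))) w.length

/-- The position after the literal at position `p`, if there is one. -/
def skip (w : List Bool) (p : ℕ) : ℕ := p + bitN w p * (3 + run w (p + 2))

/-- The position after the clause at position `q`, if there is one. -/
def next (w : List Bool) (q : ℕ) : ℕ :=
  q + bitN w q * (skip w (skip w (skip w (q + 1))) + 1 - q)

/-- The position of the clause with index `c`. -/
def clausePos (w : List Bool) (c : ℕ) : ℕ :=
  Nat.rec (run w 0 + 1) (fun _ q => min w.length (next w q)) c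

/-- The position of the literal with index `j` in the clause with index `c`. -/
def litPos (w : List Bool) (c j : ℕ) : ℕ :=
  Nat.rec (clausePos w c + 1) (fun _ p => min w.length (skip w p)) j

/-- Whether the clause `c` and its literal `j` exist. -/
def litExists (w : List Bool) (c j : ℕ) : ℕ := bitN w (clausePos w c) * bitN w (litPos w c j)

/-- The variable of the literal with index `j` in the clause with index `c`. For missing literals
this is an additional variable. -/
def litVar (w : List Bool) (c j : ℕ) : ℕ :=
  litExists w c j * run w (litPos w c j + 2) + (1 - litExists w c j) * run w 0

/-- The sign of the literal with index `j` in the clause with index `c`. Missing literals are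
negative, the literals of missing clauses are positive. -/
def litSgn (w : List Bool) (c j : ℕ) : ℕ :=
  litExists w c j * bitN w (litPos w c j + 1) + (1 - bitN w (clausePos w c))

theorem bitN_le (w : List Bool) (p : ℕ) : bitN w p ≤ 1 := Bool.toNat_le _

theorem litSgn_lt (w : List Bool) (c j : ℕ) : litSgn w c j < 2 := by
  have h₁ := bitN_le w (clausePos w c)
  have h₂ := bitN_le w (litPos w c j)
  have h₃ := bitN_le w (litPos w c j + 1)
  unfold litSgn litExists
  interval_cases bitN w (clausePos w c) <;> interval_cases bitN w (litPos w c j) <;> omega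

section Expr

/-- An expression for `run`. -/
def runE (q : Expr) : Expr :=
  lett q (iter len (const 0) len (add (var 0) (bit (add (var 2) (var 0)))))

/-- An expression for `skip`. -/
def skipE (p : Expr) : Expr :=
  lett p (add (var 0) (mul (bit (var 0)) (add (const 3) (runE (add (var 0) (const 2))))))

/-- An expression for `next`. -/
def nextE (q : Expr) : Expr :=
  lett q (add (var 0) (mul (bit (var 0))
    (sub (add (skipE (skipE (skipE (add (var 0) (const 1))))) (const 1)) (var 0))))

/-- An expression for `clausePos`. -/
def clausePosE (c : Expr) : Expr :=
  iter c (add (runE (const 0)) (const 1)) len (nextE (var 0))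

/-- An expression for `litPos`. -/
def litPosE (c j : Expr) : Expr :=
  iter j (add (clausePosE c) (const 1)) len (skipE (var 0))

/-- An expression for `litExists`. -/
def litExistsE (c j : Expr) : Expr := mul (bit (clausePosE c)) (bit (litPosE c j))

/-- An expression for `litVar`. -/
def litVarE (c j : Expr) : Expr :=
  add (mul (litExistsE c j) (runE (add (litPosE c j) (const 2))))
    (mul (sub (const 1) (litExistsE c j)) (runE (const 0)))

/-- An expression for `litSgn`. -/
def litSgnE (c j : Expr) : Expr :=
  add (mul (litExistsE c j) (bit (add (litPosE c j) (const 1))))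
    (sub (const 1) (bit (clausePosE c)))

variable (w : List Bool) (env : ℕ → ℕ) (c j : Expr)

/-- The arithmetic functions above were written with exactly the recursions and caps of `iter`, so
they agree with the values of the expressions by definition. -/
theorem eval_litVarE :
    (litVarE c j).eval w env = litVar w (c.eval w env) (j.eval w env) := rfl

theorem eval_litSgnE :
    (litSgnE c j).eval w env = litSgn w (c.eval w env) (j.eval w env) := rfl

end Expr

/-! ### Correctness of the decoding of formulas. -/

variable {w l rest : List Bool} {p : ℕ}

theorem getD_of_drop (h : w.drop p = l) (i : ℕ) : w.getD (p + i) false = l.getD i false := by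
  subst h
  simp [List.getD_eq_getElem?_getD]

theorem bitN_of_drop {b : Bool} (h : w.drop p = b :: l) : bitN w p = b.toNat := by
  have := getD_of_drop h 0
  rw [bitN, ← Nat.add_zero p, this]
  rfl

theorem drop_add_of_drop (h : w.drop p = l) (i : ℕ) : w.drop (p + i) = l.drop i := by
  rw [← h, List.drop_drop]

theorem lt_length_of_drop (h : w.drop p = l) (hl : l ≠ []) : p < w.length := by
  by_contra hp
  exact hl (h ▸ List.drop_eq_nil_of_le (not_lt.1 hp))

/-- After `t` rounds the counter is `min t v`: it stops at the first `false`. Since `v < w.length`,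
there are enough rounds and the cap has no effect. -/
theorem run_eq_of_drop {v : ℕ} (h : w.drop p = List.replicate v true ++ false :: rest) :
    run w p = v := by
  have hlen : v < w.length := by
    have := congrArg List.length h
    simp at this
    omega
  have key : ∀ t, Nat.rec (motive := fun _ => ℕ) 0
      (fun _ r => min w.length (r + bitN w (p + r))) t = min t v := by
    intro t
    induction t with
    | zero => simp
    | succ t ih =>
      change min w.length (_ + bitN w (p + _)) = _
      rw [ih, bitN, getD_of_drop h]
      rcases lt_or_ge t v with ht | ht
      · have : min t v < v := by omega
        rw [List.getD_append _ _ _ _ (by simpa using this)]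
        simp [List.getD_eq_getElem?_getD, ht]
        omega
      · have : min t v = v := by omega
        rw [this, List.getD_append_right _ _ _ _ (by simp)]
        simp
        omega
  rw [run, key]
  omega

theorem unaryCode_append (v : ℕ) (l : List Bool) :
    unaryCode v ++ l = List.replicate v true ++ false :: l := by
  simp [unaryCode]

variable {n : ℕ}

theorem listCode_nil {α : Type} (e : α → List Bool) : listCode e [] = [false] := rfl

theorem listCode_cons {α : Type} (e : α → List Bool) (a : α) (l : List α) :
    listCode e (a :: l) = true :: (e a ++ listCode e l) := by
  simp [listCode]

theorem listCode_ne_nil {α : Type} (e : α → List Bool) (l : List α) : listCode e l ≠ [] := by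
  simp [listCode]

/-- The code of a clause. -/
def clauseCode (c : List (Fin n × Bool)) : List Bool :=
  listCode (fun l : Fin n × Bool => l.2 :: unaryCode l.1) c

theorem clauseCode_nil : clauseCode ([] : List (Fin n × Bool)) = [false] := rfl

theorem clauseCode_cons (l : Fin n × Bool) (c : List (Fin n × Bool)) :
    clauseCode (l :: c) = true :: l.2 :: (unaryCode l.1 ++ clauseCode c) :=
  listCode_cons _ _ _

/-- A literal of variable `v` takes `3 + v` bits: the continuation mark, the sign, and `v + 1` bits
of unary code. At the closing `false` of a clause `skip` stays in place, just as `[].tail = []`, so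
applying it three times passes any clause of at most three literals. -/
theorem drop_skip (c : List (Fin n × Bool)) (h : w.drop p = clauseCode c ++ rest) :
    w.drop (skip w p) = clauseCode c.tail ++ rest := by
  cases c with
  | nil =>
    have := bitN_of_drop (h.trans (List.cons_append ..))
    simpa [skip, this] using h
  | cons l c =>
    rw [clauseCode_cons, List.cons_append, List.cons_append, List.append_assoc,
      unaryCode_append] at h
    have h₁ := bitN_of_drop h
    have h₂ := drop_add_of_drop h 2
    have h₃ := run_eq_of_drop h₂
    have h₄ := drop_add_of_drop h₂ (l.1 + 1)
    have h₅ : skip w p = p + 2 + (l.1 + 1) := by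
      rw [skip, h₁, h₃]
      simp
      omega
    rw [h₅, h₄]
    simp [List.drop_append]

theorem drop_next (c : List (Fin n × Bool)) (hc : c.length ≤ 3)
    (h : w.drop p = true :: (clauseCode c ++ rest)) : w.drop (next w p) = rest := by
  have h₁ := bitN_of_drop h
  have h₂ : w.drop (p + 1) = clauseCode c ++ rest := drop_add_of_drop h 1
  have h₃ := drop_skip _ (drop_skip _ (drop_skip _ h₂))
  have h₄ : c.tail.tail.tail = [] := by
    apply List.eq_nil_of_length_eq_zero
    simp
    omega
  rw [h₄, clauseCode_nil] at h₃
  have h₅ := drop_add_of_drop h₃ 1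
  have h₆ : ∀ q, q ≤ skip w q := fun q => Nat.le_add_right _ _
  have h₇ : next w p = skip w (skip w (skip w (p + 1))) + 1 := by
    rw [next, h₁]
    have := h₆ (p + 1)
    have := h₆ (skip w (p + 1))
    have := h₆ (skip w (skip w (p + 1)))
    simp
    omega
  rw [h₇, h₅]
  rfl

section Formula

variable (φ : CNFFormula 3)

theorem run_zero : run φ.code 0 = φ.numVars := by
  refine run_eq_of_drop (rest := listCode clauseCode φ.clauses) ?_
  rw [List.drop_zero, ← unaryCode_append]
  rfl

theorem drop_clausePos (c : ℕ) :
    φ.code.drop (clausePos φ.code c) = listCode clauseCode (φ.clauses.drop c) := by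
  induction c with
  | zero =>
    change φ.code.drop (run φ.code 0 + 1) = _
    rw [run_zero, List.drop_zero, CNFFormula.code]
    have : (unaryCode φ.numVars).length = φ.numVars + 1 := by simp [unaryCode]
    rw [← this, List.drop_left]
    rfl
  | succ c ih =>
    have key : φ.code.drop (next φ.code (clausePos φ.code c))
        = listCode clauseCode (φ.clauses.drop (c + 1)) := by
      rcases lt_or_ge c φ.clauses.length with hc | hc
      · rw [List.drop_eq_getElem_cons hc, listCode_cons] at ih
        exact drop_next _ (φ.width _ (List.getElem_mem hc)) ih
      · rw [List.drop_eq_nil_of_le hc, listCode_nil] at ih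
        rw [List.drop_eq_nil_of_le (hc.trans (Nat.le_succ c)), listCode_nil]
        have := bitN_of_drop ih
        simpa [next, this] using ih
    change φ.code.drop (min φ.code.length (next φ.code (clausePos φ.code c))) = _
    -- The code of a list is never empty, so the new position lies inside the input and the cap has
    -- no effect.
    rw [min_eq_right (lt_length_of_drop key (listCode_ne_nil _ _)).le, key]

theorem bitN_clausePos (c : ℕ) :
    bitN φ.code (clausePos φ.code c) = (decide (c < φ.clauses.length)).toNat := by
  have h := drop_clausePos φ c
  rcases lt_or_ge c φ.clauses.length with hc | hc
  · rw [List.drop_eq_getElem_cons hc, listCode_cons] at h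
    simp [bitN_of_drop h, hc]
  · rw [List.drop_eq_nil_of_le hc, listCode_nil] at h
    simp [bitN_of_drop h, not_lt.2 hc]

theorem drop_litPos {c : ℕ} (hc : c < φ.clauses.length) (j : ℕ) :
    φ.code.drop (litPos φ.code c j) = clauseCode (φ.clauses[c].drop j) ++
      listCode clauseCode (φ.clauses.drop (c + 1)) := by
  induction j with
  | zero =>
    have h := drop_clausePos φ c
    rw [List.drop_eq_getElem_cons hc, listCode_cons] at h
    exact drop_add_of_drop h 1
  | succ j ih =>
    have key := drop_skip _ ih
    change φ.code.drop (min φ.code.length (skip φ.code (litPos φ.code c j))) = _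
    rw [min_eq_right (lt_length_of_drop key (by simp [clauseCode, listCode])).le, key, List.tail_drop]

theorem lit_of_lt {c j : ℕ} (hc : c < φ.clauses.length) (hj : j < φ.clauses[c].length) :
    litVar φ.code c j = φ.clauses[c][j].1 ∧ litSgn φ.code c j = φ.clauses[c][j].2.toNat := by
  have h := drop_litPos φ hc j
  rw [List.drop_eq_getElem_cons hj, clauseCode_cons, List.cons_append, List.cons_append,
    List.append_assoc, unaryCode_append] at h
  have h₁ := bitN_of_drop h
  have h₂ := bitN_of_drop (drop_add_of_drop h 1)
  have h₃ := run_eq_of_drop (drop_add_of_drop h 2)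
  simp [litVar, litSgn, litExists, bitN_clausePos, hc, h₁, h₂, h₃]

theorem lit_of_ge {c j : ℕ} (hc : c < φ.clauses.length) (hj : φ.clauses[c].length ≤ j) :
    litVar φ.code c j = φ.numVars ∧ litSgn φ.code c j = 0 := by
  have h := drop_litPos φ hc j
  rw [List.drop_eq_nil_of_le hj, clauseCode_nil] at h
  have h₁ := bitN_of_drop h
  simp [litVar, litSgn, litExists, bitN_clausePos, hc, h₁, run_zero]

theorem lit_of_clause_ge {c : ℕ} (j : ℕ) (hc : φ.clauses.length ≤ c) :
    litVar φ.code c j = φ.numVars ∧ litSgn φ.code c j = 1 := by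
  simp [litVar, litSgn, litExists, bitN_clausePos, not_lt.2 hc, run_zero]

theorem length_clauses_lt : φ.clauses.length < φ.code.length := by
  have : ∀ l : List (List (Fin φ.numVars × Bool)), l.length < (listCode clauseCode l).length := by
    intro l
    induction l with
    | nil => simp [listCode]
    | cons a l ih =>
      rw [listCode_cons]
      simp
      omega
  have h := this φ.clauses
  have h' : φ.code = unaryCode φ.numVars ++ listCode clauseCode φ.clauses := rfl
  rw [h', List.length_append]
  omega

theorem numVars_lt : φ.numVars < φ.code.length := by
  rw [CNFFormula.code, List.length_append, unaryCode, List.length_append]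
  simp
  omega

theorem litVar_lt (c j : ℕ) : litVar φ.code c j < φ.code.length := by
  have hn := numVars_lt φ
  rcases lt_or_ge c φ.clauses.length with hc | hc
  · rcases lt_or_ge j φ.clauses[c].length with hj | hj
    · rw [(lit_of_lt φ hc hj).1]
      omega
    · rwa [(lit_of_ge φ hc hj).1]
  · rwa [(lit_of_clause_ge φ j hc).1]

theorem satisfiable_iff : φ.Satisfiable ↔ ∃ α : ℕ → Bool, ∀ c < φ.code.length, ∃ j < 3,
    (α (litVar φ.code c j)).toNat = litSgn φ.code c j := by
  constructor
  · rintro ⟨x, hx⟩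
    -- The additional variable `φ.numVars` becomes true, which satisfies all missing clauses.
    refine ⟨fun i => if h : i < φ.numVars then x ⟨i, h⟩ else true, fun c _ => ?_⟩
    rcases lt_or_ge c φ.clauses.length with hc | hc
    · obtain ⟨l, hl, hxl⟩ := hx _ (List.getElem_mem hc)
      obtain ⟨j, hj, rfl⟩ := List.getElem_of_mem hl
      refine ⟨j, hj.trans_le (φ.width _ (List.getElem_mem hc)), ?_⟩
      rw [(lit_of_lt φ hc hj).1, (lit_of_lt φ hc hj).2]
      simp [hxl]
    · refine ⟨0, by norm_num, ?_⟩
      rw [(lit_of_clause_ge φ 0 hc).1, (lit_of_clause_ge φ 0 hc).2]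
      simp
  · rintro ⟨α, hα⟩
    -- The index `φ.clauses.length` is still below the code length, so there is at least one missing
    -- clause. It forces the additional variable to be true and thereby makes the negative filler
    -- literals of short clauses false.
    have hn : α φ.numVars = true := by
      obtain ⟨j, -, h⟩ := hα _ (length_clauses_lt φ)
      rw [(lit_of_clause_ge φ j le_rfl).1, (lit_of_clause_ge φ j le_rfl).2] at h
      simpa using h
    refine ⟨fun i => α i, fun l hl => ?_⟩
    obtain ⟨c, hc, rfl⟩ := List.getElem_of_mem hl
    obtain ⟨j, -, h⟩ := hα c (hc.trans (length_clauses_lt φ))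
    rcases lt_or_ge j φ.clauses[c].length with hj | hj
    · refine ⟨_, List.getElem_mem hj, ?_⟩
      rw [(lit_of_lt φ hc hj).1, (lit_of_lt φ hc hj).2] at h
      have key : ∀ a b : Bool, a.toNat = b.toNat → a = b := by decide
      exact key _ _ h
    · rw [(lit_of_ge φ hc hj).1, (lit_of_ge φ hc hj).2, hn] at h
      simp at h

end Formula

end CNFCode

/-! ### A graph construction for Edge Clique Cover -/

namespace ECCInstance

/-- A collection of at most `k` cliques becomes a family indexed by `Fin k` by filling up with empty
sets; conversely, repetitions in a family only make its image smaller. -/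
theorem hasCover_comap_iff {W : Type} {n : ℕ} (e : Fin n ≃ W) (G : SimpleGraph W) (k : ℕ) :
    (⟨n, G.comap e, k⟩ : ECCInstance).HasCover ↔ ∃ F : Fin k → Set W,
      (∀ i, G.IsClique (F i)) ∧ ∀ u v, G.Adj u v → ∃ i, u ∈ F i ∧ v ∈ F i := by
  classical
  constructor
  · rintro ⟨𝒞, hk, hcl, hcov⟩
    refine ⟨fun i => if h : (i : ℕ) < 𝒞.card then
      {w | e.symm w ∈ (𝒞.equivFin.symm ⟨i, h⟩ : Finset (Fin n))} else ∅, fun i => ?_,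
      fun u v huv => ?_⟩
    · dsimp only
      split_ifs with h
      · intro u hu v hv huv
        have := hcl _ (𝒞.equivFin.symm ⟨i, h⟩).2 hu hv (e.symm.injective.ne huv)
        simpa using this
      · simp
    · obtain ⟨K, hK, hu, hv⟩ := hcov (e.symm u) (e.symm v) (by simpa using huv)
      refine ⟨⟨𝒞.equivFin ⟨K, hK⟩, (𝒞.equivFin ⟨K, hK⟩).2.trans_le hk⟩, ?_⟩
      simp only [Fin.is_lt, Fin.eta, Equiv.symm_apply_apply, dite_true, Set.mem_ofPred_eq]
      exact ⟨hu, hv⟩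
  · rintro ⟨F, hcl, hcov⟩
    refine ⟨Finset.univ.image fun i => Finset.univ.filter fun x => e x ∈ F i,
      Finset.card_image_le.trans (by simp), ?_, ?_⟩
    · simp only [Finset.mem_image, Finset.mem_univ, true_and, forall_exists_index]
      rintro _ i rfl u hu v hv huv
      exact hcl i (by simpa using hu) (by simpa using hv) (e.injective.ne huv)
    · intro u v huv
      obtain ⟨i, hu, hv⟩ := hcov _ _ huv
      exact ⟨_, Finset.mem_image_of_mem _ (Finset.mem_univ i), by simpa using hu, by simpa using hv⟩

end ECCInstance

/-- The vertices of the graph constructed from a family of sets. -/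
inductive Node (V I : Type)
  | vert (v : V)
  | hub
  | root
  | tag (i : I)

namespace Node

variable {V I : Type} (mem : I → V → Prop)

/-- Two elements are adjacent if some set contains both, the hub is adjacent to all elements, the
root is adjacent to all elements and all tags, and a tag is adjacent to the elements of its set. -/
def Adj : Node V I → Node V I → Prop
  | vert u, vert v => u ≠ v ∧ ∃ i, mem i u ∧ mem i v
  | vert _, hub => True
  | vert _, root => True
  | vert v, tag i => mem i v
  | hub, vert _ => True
  | root, vert _ => True
  | root, tag _ => True
  | tag i, vert v => mem i v
  | tag _, root => True
  | _, _ => False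

/-- The graph constructed from a family of sets. -/
def graph : SimpleGraph (Node V I) where
  Adj := Adj mem
  symm := ⟨by
    rintro (_ | _ | _ | _) (_ | _ | _ | _) h <;> simp_all only [Adj]
    exact ⟨h.1.symm, h.2.imp fun _ => And.symm⟩⟩
  loopless := ⟨by rintro (_ | _ | _ | _) h <;> simp_all [Adj]⟩

/-- The graph has an edge clique cover with four cliques more than there are sets if and only if
the elements can be coloured with four colours such that any two elements of the same colour belong
to a common set. -/
theorem exists_cover_iff [Fintype I] {k : ℕ} (hk : k = Fintype.card I + 4)
    (hmem : ∀ v, ∃ i, mem i v) :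
    (∃ F : Fin k → Set (Node V I), (∀ i, (graph mem).IsClique (F i)) ∧
      ∀ u v, (graph mem).Adj u v → ∃ i, u ∈ F i ∧ v ∈ F i) ↔
    ∃ col : V → Fin 4, ∀ u v, col u = col v → u ≠ v → ∃ i, mem i u ∧ mem i v := by
  classical
  constructor
  · rintro ⟨F, hcl, hcov⟩
    -- Tags are pairwise nonadjacent, so the edges from `root` to the tags lie in `card I` different
    -- cliques. As `root` and `hub` are not adjacent, the edges at `hub` must be covered by the four
    -- other cliques, which become the colours.
    choose κ hκ using fun i => hcov root (tag i) trivial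
    choose c hc using fun v => hcov hub (vert v) trivial
    have hinj : Function.Injective κ := by
      intro i j hij
      by_contra hne
      exact hcl (κ i) (hκ i).2 (hij ▸ (hκ j).2) (by simpa using hne)
    have hcκ : ∀ v, c v ∉ Set.range κ := by
      rintro v ⟨i, hi⟩
      exact hcl (c v) (hc v).1 (hi ▸ (hκ i).1) (by simp)
    have hcard : Fintype.card {x // x ∉ Set.range κ} = 4 := by
      rw [Fintype.card_subtype_compl, Fintype.card_fin,
        show Fintype.card {x // x ∈ Set.range κ} = Fintype.card I from Set.card_range_of_injective hinj]
      omega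
    refine ⟨fun v => Fintype.equivFinOfCardEq hcard ⟨c v, hcκ v⟩, fun u v h huv => ?_⟩
    have h' : c u = c v := by simpa using h
    have hadj : Adj mem (vert u) (vert v) :=
      @hcl (c u) (vert u) (hc u).2 (vert v) (h' ▸ (hc v).2) (by simpa using huv)
    exact hadj.2
  · rintro ⟨col, hcol⟩
    have e : Fin k ≃ I ⊕ Fin 4 := Fintype.equivOfCardEq (by simp [hk])
    -- The clique of a set `i` consists of its elements, `root` and `tag i`; the clique of a colour
    -- consists of the elements of this colour and `hub`. By `hmem` the former also cover the edges
    -- between `root` and the elements.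
    let S : I ⊕ Fin 4 → Node V I → Prop := fun x => Sum.rec
      (fun i y => Node.rec (fun v => mem i v) False True (fun j => j = i) y)
      (fun c y => Node.rec (fun v => col v = c) True False (fun _ => False) y) x
    have hS : ∀ z u v, S z u → S z v → u ≠ v → Adj mem u v := by
      rintro (i | c) (u | _ | _ | j) (v | _ | _ | j') hu hv huv <;>
        first
          | exact hu.elim
          | exact hv.elim
          | exact (huv rfl).elim
          | exact trivial
          | exact ⟨fun h => huv (congrArg vert h), i, hu, hv⟩
          | exact ⟨fun h => huv (congrArg vert h),
              hcol _ _ (hu.trans hv.symm) fun h => huv (congrArg vert h)⟩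
          | exact (show j' = i from hv) ▸ hu
          | exact (show j = i from hu) ▸ hv
          | exact (huv (congrArg tag (hu.trans hv.symm))).elim
    refine ⟨fun x => {y | S (e x) y}, fun x u hu v hv huv => hS _ u v hu hv huv, ?_⟩
    · intro u v huv
      suffices ∃ z, S z u ∧ S z v by
        obtain ⟨z, hz⟩ := this
        exact ⟨e.symm z, by simpa using hz⟩
      rcases u with u | _ | _ | j <;> rcases v with v | _ | _ | j' <;> try exact huv.elim
      · obtain ⟨i, hi⟩ := huv.2
        exact ⟨.inl i, hi⟩
      · exact ⟨.inr (col u), rfl, trivial⟩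
      · obtain ⟨i, hi⟩ := hmem u
        exact ⟨.inl i, hi, trivial⟩
      · exact ⟨.inl j', huv, rfl⟩
      · exact ⟨.inr (col v), trivial, rfl⟩
      · obtain ⟨i, hi⟩ := hmem v
        exact ⟨.inl i, trivial, hi⟩
      · exact ⟨.inl j', trivial, rfl⟩
      · exact ⟨.inl j, rfl, huv⟩
      · exact ⟨.inl j, rfl, trivial⟩

end Node

/-! ### Satisfiability as a colouring problem -/

namespace FormulaGraph

/-- The binary digit of `x` at position `t`. -/
def digit (x t : ℕ) : ℕ := x / 2 ^ t % 2

theorem digit_lt (x t : ℕ) : digit x t < 2 := Nat.mod_lt _ two_pos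

theorem exists_digit_ne {x y l : ℕ} (hx : x < 2 ^ l) (hy : y < 2 ^ l) :
    (∃ t < l, digit x t ≠ digit y t) ↔ x ≠ y := by
  refine ⟨?_, fun hne => ?_⟩
  · rintro ⟨t, -, h⟩ rfl
    exact h rfl
  · by_contra! h
    refine hne (Nat.eq_of_testBit_eq fun t => ?_)
    rcases lt_or_ge t l with ht | ht
    · rw [Nat.testBit_eq_decide_div_mod_eq, Nat.testBit_eq_decide_div_mod_eq]
      exact congrArg (fun z => decide (z = 1)) (h t ht)
    · rw [Nat.testBit_lt_two_pow (hx.trans_le (Nat.pow_le_pow_right two_pos ht)),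
        Nat.testBit_lt_two_pow (hy.trans_le (Nat.pow_le_pow_right two_pos ht))]

/-- Half of the relation `TypeRel`. -/
def TypeRelAux (s s' : ℕ) : Prop :=
  (s / 8 < 2 ∧ s' / 8 < 2 ∧ s / 4 % 2 ≠ s' / 4 % 2) ∨
  (2 ≤ s / 8 ∧ s / 8 < 5 ∧ 2 ≤ s' / 8 ∧ s' / 8 < 5 ∧ s / 4 % 2 ≠ s' / 4 % 2) ∨
  (s / 8 < 2 ∧ 5 ≤ s' / 8 ∧ s' / 8 < 7) ∨
  (2 ≤ s / 8 ∧ s / 8 < 5 ∧ 5 ≤ s' / 8 ∧ s' / 8 ≠ 6) ∨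
  (s / 8 < 2 ∧ 2 ≤ s' / 8 ∧ s' / 8 < 5 ∧ (s / 4 % 2 ≠ s' / 2 % 2 ∨ s / 8 = s' % 2))

/-- Compatibility of the types of two elements at a given position. -/
def TypeRel (s s' : ℕ) : Prop := s / 8 = s' / 8 ∨ TypeRelAux s s' ∨ TypeRelAux s' s

instance (s s' : ℕ) : Decidable (TypeRel s s') := by
  unfold TypeRel TypeRelAux
  infer_instance

theorem TypeRel.refl (s : ℕ) : TypeRel s s := .inl rfl

theorem TypeRel.symm {s s' : ℕ} (h : TypeRel s s') : TypeRel s' s :=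
  h.imp Eq.symm Or.symm

section Colouring

variable (var sgn : ℕ → ℕ → ℕ) (l B : ℕ)

/-- The type of the element `a` of sort `τ` at position `t`. The elements of the sorts `0` and `1`
are the negative and positive literals, those of the sorts `2`, `3`, `4` the occurrences of literals
in clauses, the remaining sorts are copies of the four colours. -/
def typ (t τ a : ℕ) : ℕ :=
  τ * 8 + digit a t * 4 + digit (var a (τ - 2)) t * 2 + digit (sgn a (τ - 2)) 0

theorem typ_lt {t τ a : ℕ} (hτ : τ < 9) : typ var sgn t τ a < 72 := by
  have h₁ := digit_lt a t
  have h₂ := digit_lt (var a (τ - 2)) t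
  have h₃ := digit_lt (sgn a (τ - 2)) 0
  unfold typ
  omega

/-- Half of the compatibility relation of two elements. -/
def CompatAux (τ a τ' a' : ℕ) : Prop :=
  (τ < 2 ∧ τ' < 2 ∧ a ≠ a') ∨
  (2 ≤ τ ∧ τ < 5 ∧ 2 ≤ τ' ∧ τ' < 5 ∧ a ≠ a') ∨
  (τ < 2 ∧ 5 ≤ τ' ∧ τ' < 7) ∨
  (2 ≤ τ ∧ τ < 5 ∧ 5 ≤ τ' ∧ τ' ≠ 6) ∨
  (τ < 2 ∧ 2 ≤ τ' ∧ τ' < 5 ∧ (a ≠ var a' (τ' - 2) ∨ τ = sgn a' (τ' - 2)))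

/-- A type packs the sort and three binary digits into one number, from which they can be recovered.
-/
theorem typeRelAux_typ (t τ a τ' a' : ℕ) :
    TypeRelAux (typ var sgn t τ a) (typ var sgn t τ' a') ↔
      (τ < 2 ∧ τ' < 2 ∧ digit a t ≠ digit a' t) ∨
      (2 ≤ τ ∧ τ < 5 ∧ 2 ≤ τ' ∧ τ' < 5 ∧ digit a t ≠ digit a' t) ∨
      (τ < 2 ∧ 5 ≤ τ' ∧ τ' < 7) ∨
      (2 ≤ τ ∧ τ < 5 ∧ 5 ≤ τ' ∧ τ' ≠ 6) ∨
      (τ < 2 ∧ 2 ≤ τ' ∧ τ' < 5 ∧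
        (digit a t ≠ digit (var a' (τ' - 2)) t ∨ τ = digit (sgn a' (τ' - 2)) 0)) := by
  have key : ∀ τ a, typ var sgn t τ a / 8 = τ ∧ typ var sgn t τ a / 4 % 2 = digit a t ∧
      typ var sgn t τ a / 2 % 2 = digit (var a (τ - 2)) t ∧
      typ var sgn t τ a % 2 = digit (sgn a (τ - 2)) 0 := by
    intro τ a
    have h₁ := digit_lt a t
    have h₂ := digit_lt (var a (τ - 2)) t
    have h₃ := digit_lt (sgn a (τ - 2)) 0
    unfold typ
    omega
  obtain ⟨h₁, h₂, -, -⟩ := key τ a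
  obtain ⟨h₁', h₂', h₃', h₄'⟩ := key τ' a'
  rw [TypeRelAux, h₁, h₂, h₁', h₂', h₃', h₄']

variable {l B}

/-- Inequality of indices is a disjunction over digit positions, so the existential quantifier
passes through the cases. Cases that do not depend on the position are witnessed by position `0`,
whence `0 < l`. -/
theorem exists_typeRelAux_iff (hl : 0 < l) (hB : B ≤ 2 ^ l) (hvar : ∀ c j, var c j < B)
    (hsgn : ∀ c j, sgn c j < 2) {τ a τ' a' : ℕ} (ha : a < B) (ha' : a' < B) :
    (∃ t < l, TypeRelAux (typ var sgn t τ a) (typ var sgn t τ' a')) ↔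
      CompatAux var sgn τ a τ' a' := by
  have h₁ := exists_digit_ne (ha.trans_le hB) (ha'.trans_le hB)
  have h₂ := exists_digit_ne (ha.trans_le hB) ((hvar a' (τ' - 2)).trans_le hB)
  have h₃ : digit (sgn a' (τ' - 2)) 0 = sgn a' (τ' - 2) := by
    simp [digit, Nat.mod_eq_of_lt (hsgn _ _)]
  simp only [typeRelAux_typ, CompatAux, h₃, ← h₁, ← h₂]
  constructor
  · rintro ⟨t, ht, h | h | h | h | ⟨h, h', h'', h''' | h'''⟩⟩
    · exact .inl ⟨h.1, h.2.1, t, ht, h.2.2⟩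
    · exact .inr (.inl ⟨h.1, h.2.1, h.2.2.1, h.2.2.2.1, t, ht, h.2.2.2.2⟩)
    · exact .inr (.inr (.inl h))
    · exact .inr (.inr (.inr (.inl h)))
    · exact .inr (.inr (.inr (.inr ⟨h, h', h'', .inl ⟨t, ht, h'''⟩⟩)))
    · exact .inr (.inr (.inr (.inr ⟨h, h', h'', .inr h'''⟩)))
  · rintro (⟨h, h', t, ht, h''⟩ | ⟨g, g', h, h', t, ht, h''⟩ | h | h |
      ⟨h, h', h'', ⟨t, ht, h'''⟩ | h'''⟩)
    · exact ⟨t, ht, .inl ⟨h, h', h''⟩⟩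
    · exact ⟨t, ht, .inr (.inl ⟨g, g', h, h', h''⟩)⟩
    · exact ⟨0, hl, .inr (.inr (.inl h))⟩
    · exact ⟨0, hl, .inr (.inr (.inr (.inl h)))⟩
    · exact ⟨t, ht, .inr (.inr (.inr (.inr ⟨h, h', h'', .inl h'''⟩)))⟩
    · exact ⟨0, hl, .inr (.inr (.inr (.inr ⟨h, h', h'', .inr h'''⟩)))⟩

/-- Two elements are compatible if their types are compatible at some position. -/
def Compat (l τ a τ' a' : ℕ) : Prop := ∃ t < l, TypeRel (typ var sgn t τ a) (typ var sgn t τ' a')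

theorem compat_iff (hl : 0 < l) (hB : B ≤ 2 ^ l) (hvar : ∀ c j, var c j < B)
    (hsgn : ∀ c j, sgn c j < 2) {τ a τ' a' : ℕ} (ha : a < B) (ha' : a' < B) :
    Compat var sgn l τ a τ' a' ↔
      τ = τ' ∨ CompatAux var sgn τ a τ' a' ∨ CompatAux var sgn τ' a' τ a := by
  have key : ∀ t τ a, typ var sgn t τ a / 8 = τ := by
    intro t τ a
    have h₁ := digit_lt a t
    have h₂ := digit_lt (var a (τ - 2)) t
    have h₃ := digit_lt (sgn a (τ - 2)) 0
    unfold typ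
    omega
  rw [← exists_typeRelAux_iff var sgn hl hB hvar hsgn ha ha',
    ← exists_typeRelAux_iff var sgn hl hB hvar hsgn ha' ha]
  simp only [Compat, TypeRel, key]
  constructor
  · rintro ⟨t, ht, h | h | h⟩
    exacts [.inl h, .inr (.inl ⟨t, ht, h⟩), .inr (.inr ⟨t, ht, h⟩)]
  · rintro (h | ⟨t, ht, h⟩ | ⟨t, ht, h⟩)
    exacts [⟨0, hl, .inl h⟩, ⟨t, ht, .inr (.inl h)⟩, ⟨t, ht, .inr (.inr h)⟩]

theorem or_or_of_ne {β : Type} {t p q x y z : β} (hx : x = t ∨ x = p ∨ x = q)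
    (hy : y = t ∨ y = p ∨ y = q) (hz : z = t ∨ z = p ∨ z = q) (hxy : x ≠ y) (hxz : x ≠ z)
    (hyz : y ≠ z) : x = t ∨ y = t ∨ z = t := by
  grind

/-- The elements `(5, 0)`, …, `(8, 0)` have four different colours; those of `(5, 0)` and `(6, 0)`
mean true and false. A literal can only have one of these two. The occurrences in a clause avoid the
colour of `(6, 0)` and are pairwise different, so one of them is coloured true. -/
theorem exists_of_colourable (hl : 0 < l) (hB : B ≤ 2 ^ l) (hvar : ∀ c j, var c j < B)
    (hsgn : ∀ c j, sgn c j < 2) (col : Fin 9 × Fin B → Fin 4)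
    (hcol : ∀ u v, col u = col v → u ≠ v → Compat var sgn l u.1 u.2 v.1 v.2) :
    ∃ α : ℕ → Bool, ∀ c < B, ∃ j < 3, (α (var c j)).toNat = sgn c j := by
  have hB0 : 0 < B := (Nat.zero_le _).trans_lt (hvar 0 0)
  obtain ⟨f, hf⟩ : ∃ f : ℕ → ℕ → Fin 4, ∀ τ a τ' a', τ < τ' → τ' < 9 → a < B → a' < B →
      ¬ CompatAux var sgn τ a τ' a' → ¬ CompatAux var sgn τ' a' τ a → f τ a ≠ f τ' a' := by
    refine ⟨fun τ a => if h : τ < 9 ∧ a < B then col (⟨τ, h.1⟩, ⟨a, h.2⟩) else 0,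
      fun τ a τ' a' hτ hτ' ha ha' h₁ h₂ h => ?_⟩
    dsimp only at h
    rw [dif_pos ⟨hτ.trans hτ', ha⟩, dif_pos ⟨hτ', ha'⟩] at h
    rcases (compat_iff var sgn hl hB hvar hsgn ha ha').1
      (hcol _ _ h fun h => hτ.ne (congrArg (fun u => (u.1 : ℕ)) h)) with h | h | h
    exacts [hτ.ne h, h₁ h, h₂ h]
  have fin4 : ∀ p q r s x : Fin 4, p ≠ q → p ≠ r → p ≠ s → q ≠ r → q ≠ s → r ≠ s →
      x = p ∨ x = q ∨ x = r ∨ x = s := by decide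
  have hp : ∀ τ τ', 5 ≤ τ → τ < τ' → τ' < 9 → f τ 0 ≠ f τ' 0 := fun τ τ' h5 h h9 =>
    hf _ _ _ _ h h9 hB0 hB0 (by unfold CompatAux; omega) (by unfold CompatAux; omega)
  have hpal := fun x => fin4 (f 5 0) (f 6 0) (f 7 0) (f 8 0) x
    (hp _ _ (by norm_num) (by norm_num) (by norm_num))
    (hp _ _ (by norm_num) (by norm_num) (by norm_num))
    (hp _ _ (by norm_num) (by norm_num) (by norm_num))
    (hp _ _ (by norm_num) (by norm_num) (by norm_num))
    (hp _ _ (by norm_num) (by norm_num) (by norm_num))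
    (hp _ _ (by norm_num) (by norm_num) (by norm_num))
  have hx : ∀ a < B, f 0 a ≠ f 1 a := fun a ha =>
    hf _ _ _ _ one_pos (by norm_num) ha ha (by unfold CompatAux; omega)
      (by unfold CompatAux; omega)
  have hx' : ∀ τ < 2, ∀ a < B, f τ a = f 5 0 ∨ f τ a = f 6 0 := by
    intro τ hτ a ha
    have h₁ : ∀ τ', 7 ≤ τ' → τ' < 9 → f τ a ≠ f τ' 0 := fun τ' h7 h9 =>
      hf _ _ _ _ (by omega) h9 ha hB0 (by unfold CompatAux; omega) (by unfold CompatAux; omega)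
    rcases hpal (f τ a) with h | h | h | h
    exacts [.inl h, .inr h, (h₁ 7 le_rfl (by norm_num) h).elim,
      (h₁ 8 (by norm_num) (by norm_num) h).elim]
  have hy : ∀ c < B, f 2 c = f 5 0 ∨ f 3 c = f 5 0 ∨ f 4 c = f 5 0 := by
    intro c hc
    have h₁ : ∀ τ, 2 ≤ τ → τ < 5 → f τ c = f 5 0 ∨ f τ c = f 7 0 ∨ f τ c = f 8 0 := by
      intro τ h2 h5
      have h₁ : f τ c ≠ f 6 0 := hf _ _ _ _ (by omega) (by norm_num) hc hB0
        (by unfold CompatAux; omega) (by unfold CompatAux; omega)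
      exact (hpal (f τ c)).imp_right (Or.resolve_left · h₁)
    have h₂ : ∀ τ τ', 2 ≤ τ → τ < τ' → τ' < 5 → f τ c ≠ f τ' c := fun τ τ' h2 h h5 =>
      hf _ _ _ _ h (by omega) hc hc (by unfold CompatAux; omega) (by unfold CompatAux; omega)
    exact or_or_of_ne (h₁ 2 le_rfl (by norm_num)) (h₁ 3 (by norm_num) (by norm_num))
      (h₁ 4 (by norm_num) (by norm_num)) (h₂ 2 3 le_rfl (by norm_num) (by norm_num))
      (h₂ 2 4 le_rfl (by norm_num) (by norm_num)) (h₂ 3 4 (by norm_num) (by norm_num) (by norm_num))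
  have hyx : ∀ c < B, ∀ j < 3, f (j + 2) c = f 5 0 →
      (decide (f 1 (var c j) = f 5 0)).toNat = sgn c j := by
    intro c hc j hj h
    -- The literal opposite to an occurrence conflicts with it, so it cannot be coloured true as
    -- well.
    have h₁ : ∀ τ < 2, τ ≠ sgn c j → f τ (var c j) ≠ f 5 0 := by
      intro τ hτ hs
      rw [← h]
      refine hf _ _ _ _ (by omega) (by omega) (hvar c j) hc ?_ ?_
      · unfold CompatAux
        rw [Nat.add_sub_cancel]
        omega
      · unfold CompatAux
        omega
    have h0 := hx' 0 two_pos _ (hvar c j)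
    have h1 := hx' 1 one_lt_two _ (hvar c j)
    have h01 := hx _ (hvar c j)
    have hs := hsgn c j
    interval_cases hs' : sgn c j
    · simp [h₁ 1 one_lt_two (by omega)]
    · have h2 := h0.resolve_left (h₁ 0 two_pos (by omega))
      simp [h1.resolve_right fun h => h01 (h2.trans h.symm)]
  refine ⟨fun a => decide (f 1 a = f 5 0), fun c hc => ?_⟩
  rcases hy c hc with h | h | h
  exacts [⟨0, by norm_num, hyx c hc 0 (by norm_num) h⟩, ⟨1, by norm_num, hyx c hc 1 (by norm_num) h⟩,
    ⟨2, by norm_num, hyx c hc 2 (by norm_num) h⟩]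

theorem exists_colouring (hl : 0 < l) (hB : B ≤ 2 ^ l) (hvar : ∀ c j, var c j < B)
    (hsgn : ∀ c j, sgn c j < 2) {α : ℕ → Bool}
    (hα : ∀ c < B, ∃ j < 3, (α (var c j)).toNat = sgn c j) :
    ∃ col : Fin 9 × Fin B → Fin 4, ∀ u v, col u = col v → u ≠ v →
      Compat var sgn l u.1 u.2 v.1 v.2 := by
  choose! j hj hαj using hα
  -- Colour `0` is true and `1` is false. In clause `a` the occurrence `j a` of a satisfied literal
  -- gets `0`, the two others get `2` and `3`.
  let f : ℕ → ℕ → Fin 4 := fun τ a =>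
    if τ = 0 then (if α a then 1 else 0) else if τ = 1 then (if α a then 0 else 1) else
    if τ < 5 then (if τ - 2 = j a then 0 else if τ - 2 = (j a + 1) % 3 then 2 else 3) else
    if τ = 5 then 0 else if τ = 6 then 1 else if τ = 7 then 2 else 3
  have hlit : ∀ a τ, τ < 2 → (f τ a = 0 → (α a).toNat = τ) ∧ (f τ a ≠ 2) ∧ f τ a ≠ 3 := by
    intro a τ hτ
    interval_cases τ <;> cases h : α a <;> simp [f, h]
  have hlit' : ∀ a, f 0 a ≠ f 1 a := by
    intro a
    cases h : α a <;> simp [f, h]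
  have hocc : ∀ a τ, 2 ≤ τ → τ < 5 → f τ a ≠ 1 ∧ (f τ a = 0 → τ - 2 = j a) := by
    intro a τ h2 h5
    simp only [f, show τ ≠ 0 by omega, show τ ≠ 1 by omega, h5, if_true, if_false]
    split_ifs <;> simp_all
  have hocc' : ∀ a < B, ∀ τ τ', 2 ≤ τ → τ < 5 → 2 ≤ τ' → τ' < 5 → f τ a = f τ' a → τ = τ' := by
    intro a ha τ τ' h2 h5 h2' h5' h
    have hja := hj a ha
    simp only [f, show τ ≠ 0 by omega, show τ ≠ 1 by omega, h5, if_true, if_false,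
      show τ' ≠ 0 by omega, show τ' ≠ 1 by omega, h5'] at h
    split_ifs at h <;> omega
  have hpal : ∀ a, f 5 a = 0 ∧ f 6 a = 1 ∧ f 7 a = 2 ∧ f 8 a = 3 := by
    intro a
    simp [f]
  have key : ∀ τ τ' a a', τ < τ' → τ' < 9 → a < B → a' < B → f τ a = f τ' a' →
      CompatAux var sgn τ a τ' a' := by
    intro τ τ' a a' hτ hτ' ha ha' h
    rcases lt_or_ge τ 2 with h2 | h2
    · rcases lt_or_ge τ' 2 with h2' | h2'
      · obtain ⟨rfl, rfl⟩ : τ = 0 ∧ τ' = 1 := by omega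
        exact .inl ⟨h2, h2', by rintro rfl; exact hlit' _ h⟩
      · rcases lt_or_ge τ' 5 with h5 | h5
        · refine .inr (.inr (.inr (.inr ⟨h2, h2', h5, ?_⟩)))
          -- Otherwise the literal is opposite to the occurrence. Their common colour can only be
          -- `0`, so the literal is true under `α`; but an occurrence coloured `0` is satisfied by
          -- `α`, a contradiction.
          by_contra! hcon
          obtain ⟨rfl, hc⟩ := hcon
          have hl := hlit (var a' (τ' - 2)) τ h2
          have ho := hocc a' τ' h2' h5
          rw [h] at hl
          have h0 : f τ' a' = 0 := by
            have : ∀ x : Fin 4, x ≠ 1 → x ≠ 2 → x ≠ 3 → x = 0 := by decide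
            exact this _ ho.1 hl.2.1 hl.2.2
          refine hc ?_
          rw [← hl.1 h0, ho.2 h0]
          exact hαj a' ha'
        · refine .inr (.inr (.inl ⟨h2, h5, ?_⟩))
          by_contra! h7
          have hl := hlit a τ h2
          obtain rfl | rfl : τ' = 7 ∨ τ' = 8 := by omega
          · exact hl.2.1 (h.trans (hpal a').2.2.1)
          · exact hl.2.2 (h.trans (hpal a').2.2.2)
    · rcases lt_or_ge τ 5 with h5 | h5
      · rcases lt_or_ge τ' 5 with h5' | h5'
        · refine .inr (.inl ⟨h2, h5, by omega, h5', ?_⟩)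
          rintro rfl
          exact hτ.ne (hocc' a ha τ τ' h2 h5 (by omega) h5' h)
        · refine .inr (.inr (.inr (.inl ⟨h2, h5, h5', ?_⟩)))
          rintro rfl
          exact (hocc a τ h2 h5).1 (h.trans (hpal a').2.1)
      · exfalso
        have h1 := hpal a
        have h2 := hpal a'
        interval_cases τ' <;> interval_cases τ <;> simp_all
  refine ⟨fun v => f v.1 v.2, fun u v huv hne => ?_⟩
  rw [compat_iff var sgn hl hB hvar hsgn u.2.2 v.2.2]
  rcases lt_trichotomy (u.1 : ℕ) v.1 with h | h | h
  · exact .inr (.inl (key _ _ _ _ h v.1.2 u.2.2 v.2.2 huv))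
  · exact .inl h
  · exact .inr (.inr (key _ _ _ _ h u.1.2 v.2.2 u.2.2 huv.symm))

end Colouring

end FormulaGraph

/-! ### The reduction -/

namespace FormulaGraph

open Node

/-! ### The instance and its code. -/

section Instance

variable (var sgn : ℕ → ℕ → ℕ) (l B : ℕ)

/-- Membership of an element in the set belonging to two types and a position. -/
def TagMem (s s' t τ a : ℕ) : Prop :=
  typ var sgn t τ a = s ∨ typ var sgn t τ a = s' ∧ TypeRel s s'

/-- The elements. -/
abbrev Elt : Type := Fin 9 × Fin B

/-- The indices of the sets. -/
abbrev Idx : Type := Fin 72 × Fin 72 × Fin l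

/-- The family of sets. -/
def mem (i : Idx l) (v : Elt B) : Prop := TagMem var sgn i.1 i.2.1 i.2.2 v.1 v.2

variable {l B} in
-- Elements of equal type have the same sort and are therefore compatible, so each set contains only
-- compatible pairs; a pair compatible at position `t` lies in the set given by its two types there.
theorem exists_mem_iff (u v : Elt B) : (∃ i : Idx l, mem var sgn l B i u ∧ mem var sgn l B i v) ↔
    Compat var sgn l u.1 u.2 v.1 v.2 := by
  constructor
  · rintro ⟨⟨s, s', t⟩, hu | ⟨hu, h⟩, hv | ⟨hv, h'⟩⟩
    all_goals refine ⟨t, t.2, ?_⟩; rw [hu, hv]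
    exacts [.refl _, h', h.symm, .refl _]
  · rintro ⟨t, ht, h⟩
    exact ⟨⟨⟨_, typ_lt var sgn (t := t) (a := u.2) u.1.2⟩,
      ⟨_, typ_lt var sgn (t := t) (a := v.2) v.1.2⟩, ⟨t, ht⟩⟩, .inl rfl, .inr ⟨rfl, h⟩⟩

/-- The list of the vertices. -/
def nodes : List (Node (Elt B) (Idx l)) :=
  ((List.finRange 9).flatMap fun τ => (List.finRange B).flatMap fun a => [vert (τ, a)]) ++
  ([hub] ++ ([root] ++ (List.finRange 72).flatMap fun s => (List.finRange 72).flatMap fun s' =>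
    (List.finRange l).flatMap fun t => [tag (s, s', t)]))

theorem length_nodes : (nodes l B).length = 9 * B + (72 * (72 * l) + 2) := by
  simp [nodes, List.length_flatMap]
  omega

theorem mem_nodes (x : Node (Elt B) (Idx l)) : x ∈ nodes l B := by
  rcases x with ⟨τ, a⟩ | _ | _ | ⟨s, s', t⟩ <;> simp [nodes]

theorem nodup_flatMap_finRange {α : Type} {n : ℕ} {f : Fin n → List α} (h : ∀ i, (f i).Nodup)
    (h' : ∀ i j x, x ∈ f i → x ∈ f j → i = j) : ((List.finRange n).flatMap f).Nodup :=
  List.nodup_flatMap.2 ⟨fun i _ => h i, (List.nodup_finRange n).imp fun {i j} hij x hi hj =>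
    hij (h' i j x hi hj)⟩

theorem nodup_nodes : (nodes l B).Nodup := by
  have h₁ : ((List.finRange 9).flatMap fun τ => (List.finRange B).flatMap fun a =>
      [(vert (τ, a) : Node (Elt B) (Idx l))]).Nodup := by
    refine nodup_flatMap_finRange (fun τ => nodup_flatMap_finRange (by simp) ?_) ?_ <;>
      simp +contextual
  have h₂ : ((List.finRange 72).flatMap fun s => (List.finRange 72).flatMap fun s' =>
      (List.finRange l).flatMap fun t => [(tag (s, s', t) : Node (Elt B) (Idx l))]).Nodup := by
    refine nodup_flatMap_finRange (fun s => nodup_flatMap_finRange (fun s' =>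
      nodup_flatMap_finRange (by simp) ?_) ?_) ?_ <;> simp +contextual
  rw [nodes, List.nodup_append, List.nodup_append, List.nodup_append]
  refine ⟨h₁, ⟨by simp, ⟨by simp, h₂, ?_⟩, ?_⟩, ?_⟩
  · simp only [List.mem_singleton, List.mem_flatMap]
    rintro _ rfl _ ⟨_, -, _, -, _, -, rfl⟩ h
    cases h
  · simp only [List.mem_singleton, List.mem_flatMap, List.mem_append]
    rintro _ rfl _ (rfl | ⟨_, -, _, -, _, -, rfl⟩) h <;> cases h
  · simp only [List.mem_singleton, List.mem_flatMap, List.mem_append]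
    rintro _ ⟨_, -, _, -, rfl⟩ _ (rfl | rfl | ⟨_, -, _, -, _, -, rfl⟩) h <;> cases h

open scoped Classical in
/-- The instance of Edge Clique Cover. -/
noncomputable def graphInstance : ECCInstance :=
  ⟨(nodes l B).length, (graph (mem var sgn l B)).comap
    ((nodup_nodes l B).getEquivOfForallMemList _ (mem_nodes l B)), 72 * (72 * l) + 4⟩

variable {l B} in
theorem hasCover_graphInstance_iff (hl : 0 < l) (hB : B ≤ 2 ^ l) (hvar : ∀ c j, var c j < B)
    (hsgn : ∀ c j, sgn c j < 2) : (graphInstance var sgn l B).HasCover ↔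
      ∃ α : ℕ → Bool, ∀ c < B, ∃ j < 3, (α (var c j)).toNat = sgn c j := by
  refine (ECCInstance.hasCover_comap_iff _ _ _).trans ((exists_cover_iff _ (by simp)
    fun v => ?_).trans ?_)
  · obtain ⟨i, hi, -⟩ := (exists_mem_iff var sgn v v).2 ⟨0, hl, .refl _⟩
    exact ⟨i, hi⟩
  · simp only [exists_mem_iff]
    exact ⟨fun ⟨col, hcol⟩ => exists_of_colourable var sgn hl hB hvar hsgn col hcol,
      fun ⟨α, hα⟩ => exists_colouring var sgn hl hB hvar hsgn hα⟩

open scoped Classical in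
-- Writing the adjacency matrix as a double concatenation over the list of vertices matches the
-- nested repetitions of an `Out`.
theorem code_graphInstance : (graphInstance var sgn l B).code =
    unaryCode (9 * B + (72 * (72 * l) + 2)) ++ unaryCode (72 * (72 * l) + 4) ++
      (nodes l B).flatMap fun u => (nodes l B).flatMap fun v =>
        [decide (Node.Adj (mem var sgn l B) u v)] := by
  have h : ∀ g : Node (Elt B) (Idx l) → List Bool,
      ((List.finRange (nodes l B).length).flatMap fun u => g ((nodes l B).get u)) =
        (nodes l B).flatMap g := by
    intro g
    rw [← List.flatMap_map (f := (nodes l B).get), List.map_get_finRange]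
  rw [← h, ← length_nodes]
  simp only [← h]
  simp only [← List.map_eq_flatMap]
  rfl

end Instance

end FormulaGraph

namespace FormulaGraph

open Node Expr CNFCode

/-! ### Expressions for the reduction -/

section Expressions

variable (w : List Bool) (env : ℕ → ℕ)

/-- An expression for `x / 2 ^ t`. -/
def shiftE (x t : Expr) : Expr := iter t x x (half (var 0))

theorem eval_shiftE (x t : Expr) :
    (shiftE x t).eval w env = x.eval w env / 2 ^ t.eval w env := by
  change Nat.rec (motive := fun _ => ℕ) (x.eval w env) (fun _ r => min (x.eval w env) (r / 2))
    (t.eval w env) = _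
  generalize x.eval w env = a
  generalize t.eval w env = b
  induction b with
  | zero => simp
  | succ b ih =>
    change min a (_ / 2) = _
    rw [ih, Nat.div_div_eq_div_mul, ← pow_succ]
    exact min_eq_right (Nat.div_le_self _ _)

/-- An expression for `digit`. -/
def digitE (x t : Expr) : Expr :=
  lett (shiftE x t) (sub (var 0) (mul (const 2) (half (var 0))))

theorem eval_digitE (x t : Expr) :
    (digitE x t).eval w env = digit (x.eval w env) (t.eval w env) := by
  change (shiftE x t).eval w env - 2 * ((shiftE x t).eval w env / 2) = _
  rw [eval_shiftE, digit]
  omega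

/-- An expression for `typ`. -/
def typE (t τ a : Expr) : Expr :=
  add (add (add (mul τ (const 8)) (mul (digitE a t) (const 4)))
    (mul (digitE (litVarE a (sub τ (const 2))) t) (const 2)))
    (digitE (litSgnE a (sub τ (const 2))) (const 0))

theorem eval_typE (t τ a : Expr) : (typE t τ a).eval w env =
    typ (litVar w) (litSgn w) (t.eval w env) (τ.eval w env) (a.eval w env) := by
  change τ.eval w env * 8 + (digitE a t).eval w env * 4 +
    (digitE (litVarE a (sub τ (const 2))) t).eval w env * 2 +
    (digitE (litSgnE a (sub τ (const 2))) (const 0)).eval w env = _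
  rw [eval_digitE, eval_digitE, eval_digitE, eval_litVarE, eval_litSgnE]
  rfl

/-- An expression that tells whether two types are compatible. -/
def relE (s s' : Expr) : Expr :=
  tab (fun p => if TypeRel (p / 72) (p % 72) then 1 else 0) 5184 (add (mul s (const 72)) s')

theorem eval_relE {s s' : Expr} (hs : s.eval w env < 72) (hs' : s'.eval w env < 72) :
    (relE s s').eval w env = if TypeRel (s.eval w env) (s'.eval w env) then 1 else 0 := by
  change (if s.eval w env * 72 + s'.eval w env < 5184 then _ else 0) = _
  rw [if_pos (by omega)]
  change (if TypeRel ((s.eval w env * 72 + s'.eval w env) / 72)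
    ((s.eval w env * 72 + s'.eval w env) % 72) then 1 else 0) = _
  rw [show (s.eval w env * 72 + s'.eval w env) / 72 = s.eval w env by omega,
    show (s.eval w env * 72 + s'.eval w env) % 72 = s'.eval w env by omega]

/-- An expression that tells whether two numbers are equal. -/
def eqE (x y : Expr) : Expr := sub (const 1) (add (sub x y) (sub y x))

theorem eval_eqE (x y : Expr) :
    (eqE x y).eval w env = if x.eval w env = y.eval w env then 1 else 0 := by
  change 1 - ((x.eval w env - y.eval w env) + (y.eval w env - x.eval w env)) = _
  split_ifs <;> omega

/-- An expression that tells whether `TagMem` holds. -/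
def tagMemE (s s' t τ a : Expr) : Expr :=
  add (eqE (typE t τ a) s) (mul (eqE (typE t τ a) s') (relE s s'))

theorem eval_tagMemE {s s' t τ a : Expr} (hs : s.eval w env < 72) (hs' : s'.eval w env < 72) :
    (tagMemE s s' t τ a).eval w env ≠ 0 ↔ TagMem (litVar w) (litSgn w) (s.eval w env)
      (s'.eval w env) (t.eval w env) (τ.eval w env) (a.eval w env) := by
  change (eqE (typE t τ a) s).eval w env + (eqE (typE t τ a) s').eval w env *
    (relE s s').eval w env ≠ 0 ↔ _
  rw [eval_eqE, eval_eqE, eval_relE w env hs hs', eval_typE, TagMem]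
  by_cases h₁ : typ (litVar w) (litSgn w) (t.eval w env) (τ.eval w env) (a.eval w env) =
    s.eval w env
  · simp [h₁]
  · rw [if_neg h₁]
    split_ifs with h₂ h₃ h₃ <;> simp [h₁, h₂, h₃]
    exact fun h => h₁ (h₂.trans h)

/-- An expression that tells whether `e` is nonzero for some value less than `b` of variable `1`. -/
def existsE (b e : Expr) : Expr := iter b (const 0) (const 1) (add (var 0) e)

theorem eval_existsE (b e : Expr) (p : ℕ → Prop)
    (h : ∀ t < b.eval w env, ∀ r, e.eval w (scons r (scons t env)) ≠ 0 ↔ p t) :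
    (existsE b e).eval w env ≠ 0 ↔ ∃ t < b.eval w env, p t := by
  change Nat.rec (motive := fun _ => ℕ) 0
    (fun t r => min 1 (r + e.eval w (scons r (scons t env)))) (b.eval w env) ≠ 0 ↔ _
  revert h
  generalize b.eval w env = n
  intro h
  induction n with
  | zero => simp
  | succ n ih =>
    change min 1 (Nat.rec _ _ n + e.eval w (scons _ (scons n env))) ≠ 0 ↔ _
    have h₁ := ih fun t ht => h t (ht.trans n.lt_succ_self)
    have h₂ := h n n.lt_succ_self (Nat.rec (motive := fun _ => ℕ) 0
      (fun t r => min 1 (r + e.eval w (scons r (scons t env)))) n)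
    rw [Nat.exists_lt_succ_right, ← h₁, ← h₂]
    omega

/-- The binary length of the length of the input. -/
def sizeE : Expr :=
  iter len (const 0) len
    (add (var 0) (sub (const 1) (sub (const 1) (shiftE len (var 1)))))

theorem eval_sizeE : sizeE.eval w env = Nat.size w.length := by
  -- With truncated subtraction `1 - (1 - x)` indicates `x > 0`, so the sum counts the `t` with `2 ^
  -- t ≤ w.length`.
  have h : ∀ T, Nat.rec (motive := fun _ => ℕ) 0 (fun t r => min w.length (r + (1 - (1 - w.length / 2 ^ t)))) T =
      min T (Nat.size w.length) := by
    intro T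
    induction T with
    | zero => simp
    | succ T ih =>
      change min w.length (Nat.rec _ _ T + _) = _
      rw [ih]
      have h₁ : Nat.size w.length ≤ w.length := Nat.size_le.2 Nat.lt_two_pow_self
      rcases lt_or_ge T (Nat.size w.length) with h | h
      · have : 0 < w.length / 2 ^ T := Nat.div_pos (Nat.lt_size.1 h) (by positivity)
        omega
      · have : w.length / 2 ^ T = 0 := Nat.div_eq_of_lt (Nat.size_le.1 h)
        omega
  have h₂ : sizeE.eval w env =
      Nat.rec (motive := fun _ => ℕ) 0 (fun t r => min w.length (r + (1 - (1 - w.length / 2 ^ t)))) w.length := by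
    change Nat.rec (motive := fun _ => ℕ) 0 (fun t r => min w.length (r + (1 - (1 - (shiftE len (var 1)).eval w
      (scons r (scons t env)))))) w.length = _
    simp only [eval_shiftE]
    rfl
  rw [h₂, h, min_eq_right (Nat.size_le.2 Nat.lt_two_pow_self)]

end Expressions

/-! ### Writing down the instance -/

/-- Concatenation over all vertices, given a description for each kind of vertices. -/
def nodesOut (oV oH oR oT : Out) : Out :=
  .seq (.rep (const 9) (.rep len oV)) (.seq oH (.seq oR
    (.rep (const 72) (.rep (const 72) (.rep sizeE oT)))))

theorem flatMap_range {n : ℕ} (f : ℕ → List Bool) (g : Fin n → List Bool)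
    (h : ∀ i : Fin n, f i = g i) : (List.range n).flatMap f = (List.finRange n).flatMap g := by
  rw [← List.map_coe_finRange_eq_range, List.flatMap_map]
  exact congrArg (List.flatMap · _) (funext h)

theorem emit_nodesOut {w : List Bool} {env : ℕ → ℕ} {oV oH oR oT : Out}
    (G : Node (Elt w.length) (Idx (Nat.size w.length)) → List Bool)
    (hV : ∀ τ a, oV.emit w (scons (a : Fin w.length) (scons (τ : Fin 9) env)) = G (vert (τ, a)))
    (hH : oH.emit w env = G hub) (hR : oR.emit w env = G root)
    (hT : ∀ s s' t, oT.emit w (scons (t : Fin (Nat.size w.length)) (scons (s' : Fin 72)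
      (scons (s : Fin 72) env))) = G (tag (s, s', t))) :
    (nodesOut oV oH oR oT).emit w env = (nodes (Nat.size w.length) w.length).flatMap G := by
  change (List.range 9).flatMap (fun τ => (List.range w.length).flatMap fun a =>
    oV.emit w (scons a (scons τ env))) ++ (oH.emit w env ++ (oR.emit w env ++
      (List.range 72).flatMap fun s => (List.range 72).flatMap fun s' =>
        (List.range (sizeE.eval w (scons s' (scons s env)))).flatMap fun t =>
          oT.emit w (scons t (scons s' (scons s env))))) = _
  simp only [eval_sizeE]
  simp only [nodes, List.flatMap_append, List.flatMap_assoc, List.flatMap_singleton, hH, hR]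
  congr 1
  · exact flatMap_range _ _ fun τ => flatMap_range _ _ fun a => hV τ a
  · congr 2
    exact flatMap_range _ _ fun s => flatMap_range _ _ fun s' => flatMap_range _ _ fun t =>
      hT s s' t

/-- Self-delimiting unary code of the value of an expression. -/
def unaryOut (e : Expr) : Out := .seq (.rep e (.bit (const 1))) (.bit (const 0))

theorem emit_unaryOut {w : List Bool} {env : ℕ → ℕ} (e : Expr) :
    (unaryOut e).emit w env = unaryCode (e.eval w env) := by
  change ((List.range (e.eval w env)).flatMap fun _ => [true]) ++ [false] = _
  rw [unaryCode, ← List.map_eq_flatMap, List.map_const', List.length_range]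

/-- Adjacency of two elements, the first of sort `3` with index `2`, the second of sort `1` with
index `0`. -/
def eltAdjE : Expr :=
  mul (add (add (sub (var 3) (var 1)) (sub (var 1) (var 3)))
      (add (sub (var 2) (var 0)) (sub (var 0) (var 2))))
    -- Under `existsE` the variables move up by two; variable `1` is the digit position.
    (existsE sizeE (relE (typE (var 1) (var 5) (var 4)) (typE (var 1) (var 3) (var 2))))

/-- The row of the adjacency matrix of an element. -/
def eltOut : Out := nodesOut (.bit eltAdjE) (.bit (const 1)) (.bit (const 1))
  (.bit (tagMemE (var 2) (var 1) (var 0) (var 4) (var 3)))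

/-- The row of the adjacency matrix of the hub. -/
def hubOut : Out := nodesOut (.bit (const 1)) (.bit (const 0)) (.bit (const 0)) (.bit (const 0))

/-- The row of the adjacency matrix of the root. -/
def rootOut : Out := nodesOut (.bit (const 1)) (.bit (const 0)) (.bit (const 0)) (.bit (const 1))

/-- The row of the adjacency matrix of a tag. -/
def tagOut : Out := nodesOut (.bit (tagMemE (var 4) (var 3) (var 2) (var 1) (var 0)))
  (.bit (const 0)) (.bit (const 1)) (.bit (const 0))

/-- A description of the code of the instance. -/
def instanceOut : Out :=
  .seq (.seq (unaryOut (add (mul (const 9) len) (add (mul (const 72) (mul (const 72) sizeE))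
    (const 2)))) (unaryOut (add (mul (const 72) (mul (const 72) sizeE)) (const 4))))
    (nodesOut eltOut hubOut rootOut tagOut)

theorem emit_bit {w : List Bool} {env : ℕ → ℕ} {e : Expr} {p : Prop} [Decidable p]
    (h : e.eval w env ≠ 0 ↔ p) : (Out.bit e).emit w env = [decide p] := by
  change [decide (e.eval w env ≠ 0)] = _
  simp only [h]

open scoped Classical in
theorem emit_instanceOut (w : List Bool) (env : ℕ → ℕ) : instanceOut.emit w env =
    (graphInstance (litVar w) (litSgn w) (Nat.size w.length) w.length).code := by
  have h0 : ∀ env : ℕ → ℕ, (const 0).eval w env ≠ 0 ↔ False := fun _ => by simp [eval]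
  have h1 : ∀ env : ℕ → ℕ, (const 1).eval w env ≠ 0 ↔ True := fun _ => by simp [eval]
  rw [code_graphInstance]
  change (unaryOut _).emit w env ++ (unaryOut _).emit w env ++
    (nodesOut eltOut hubOut rootOut tagOut).emit w env = _
  rw [emit_unaryOut, emit_unaryOut]
  congr 1
  · change unaryCode (9 * w.length + (72 * (72 * sizeE.eval w env) + 2)) ++
      unaryCode (72 * (72 * sizeE.eval w env) + 4) = _
    rw [eval_sizeE]
  · refine emit_nodesOut _ (fun τ a => emit_nodesOut _ (fun τ' a' => emit_bit ?_)
      (emit_bit (h1 _)) (emit_bit (h1 _)) (fun s s' t => emit_bit ?_))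
      (emit_nodesOut _ (fun τ a => emit_bit (h1 _)) (emit_bit (h0 _)) (emit_bit (h0 _))
        (fun s s' t => emit_bit (h0 _)))
      (emit_nodesOut _ (fun τ a => emit_bit (h1 _)) (emit_bit (h0 _)) (emit_bit (h0 _))
        (fun s s' t => emit_bit (h1 _)))
      (fun s s' t => emit_nodesOut _ (fun τ a => emit_bit ?_) (emit_bit (h0 _)) (emit_bit (h1 _))
        (fun s s' t => emit_bit (h0 _)))
    · change (τ - τ' + (τ' - τ) + (a - a' + (a' - a)) : ℕ) *
        (existsE sizeE _).eval w _ ≠ 0 ↔ (τ, a) ≠ (τ', a') ∧ _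
      rw [mul_ne_zero_iff, exists_mem_iff]
      refine and_congr ?_ ((eval_existsE _ _ _ _ _ fun t ht r => ?_).trans (by rw [eval_sizeE]; rfl))
      · rw [ne_eq (τ, a), Prod.ext_iff, Fin.ext_iff, Fin.ext_iff]
        dsimp only
        omega
      · have key := eval_relE w (scons r (scons t (scons a' (scons τ' (scons a (scons τ env))))))
          (s := typE (var 1) (var 5) (var 4)) (s' := typE (var 1) (var 3) (var 2))
          (by rw [eval_typE]; exact typ_lt _ _ τ.2) (by rw [eval_typE]; exact typ_lt _ _ τ'.2)
        rw [key, eval_typE, eval_typE]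
        simp only [ne_eq, ite_eq_right_iff, one_ne_zero, imp_false, not_not]
        exact Iff.rfl
    · exact eval_tagMemE w _ (s := var 2) (s' := var 1) s.2 s'.2
    · exact eval_tagMemE w _ (s := var 4) (s' := var 3) s.2 s'.2

end FormulaGraph

/-! ### The running time -/

theorem DecidesInTime.mono {α : Type} {enc : α → List Bool} {p : α → Prop} {T T' : α → ℝ}
    (h : DecidesInTime enc p T) (hT : ∀ a, T a ≤ T' a) : DecidesInTime enc p T' := by
  obtain ⟨M, hM, h⟩ := h
  refine ⟨M, hM, fun a => ?_⟩
  obtain ⟨b, t, hb, ht, ho⟩ := h a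
  exact ⟨b, t, hb, ht.trans (hT a), ho⟩

namespace CNFFormula

variable (φ : CNFFormula 3)

/-- A clause is determined by its three optional entries, each one of `2 * numVars` literals or
absent; clauses are not repeated. -/
theorem length_clauses_le : φ.clauses.length ≤ (2 * φ.numVars + 1) ^ 3 := by
  have h : (φ.clauses.map fun c => fun i : Fin 3 => getElem? c (i : ℕ)).Nodup := by
    refine φ.nodup.map_on fun c hc c' hc' h => List.ext_getElem? fun i => ?_
    rcases lt_or_ge i 3 with hi | hi
    · exact congrFun h ⟨i, hi⟩
    · rw [List.getElem?_eq_none ((φ.width c hc).trans hi),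
        List.getElem?_eq_none ((φ.width c' hc').trans hi)]
  have := h.length_le_card
  simpa [mul_comm] using this

theorem length_code_le : φ.code.length + 2 ≤ 68 * (φ.numVars + 1) ^ 4 := by
  have h₁ : ∀ c ∈ φ.clauses, (true :: listCode (fun l : Fin φ.numVars × Bool =>
      l.2 :: unaryCode l.1) c).length ≤ 8 * (φ.numVars + 1) := by
    intro c hc
    have h : ((c.map fun l : Fin φ.numVars × Bool =>
        (true :: l.2 :: unaryCode l.1).length).sum) ≤ c.length * (φ.numVars + 2) := by
      rw [← smul_eq_mul, ← List.length_map (as := c)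
        (f := fun l : Fin φ.numVars × Bool => (true :: l.2 :: unaryCode l.1).length)]
      refine List.sum_le_card_nsmul _ _ fun x hx => ?_
      obtain ⟨l, -, rfl⟩ := List.mem_map.1 hx
      have := l.1.2
      simp only [unaryCode, List.length_cons, List.length_append, List.length_replicate,
        List.length_nil]
      omega
    have h3 := Nat.mul_le_mul_right (φ.numVars + 2) (φ.width c hc)
    rw [listCode, List.length_cons, List.length_append, List.length_flatMap, List.length_singleton]
    omega
  have h₂ : (φ.clauses.flatMap fun c => true :: listCode (fun l : Fin φ.numVars × Bool =>
      l.2 :: unaryCode l.1) c).length ≤ φ.clauses.length * (8 * (φ.numVars + 1)) := by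
    rw [List.length_flatMap, ← smul_eq_mul, ← List.length_map (as := φ.clauses)
      (f := fun c => (true :: listCode (fun l : Fin φ.numVars × Bool =>
        l.2 :: unaryCode l.1) c).length)]
    refine List.sum_le_card_nsmul _ _ fun x hx => ?_
    obtain ⟨c, hc, rfl⟩ := List.mem_map.1 hx
    exact h₁ c hc
  have h₃ := Nat.mul_le_mul_right (8 * (φ.numVars + 1)) φ.length_clauses_le
  have h₄ : (2 * φ.numVars + 1) ^ 3 ≤ (2 * (φ.numVars + 1)) ^ 3 :=
    Nat.pow_le_pow_left (by omega) 3
  have h₅ := Nat.mul_le_mul_right (8 * (φ.numVars + 1)) h₄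
  -- The clauses contribute at most `64 * (n + 1) ^ 4`; the remaining `n + 4` is at most `4 * (n +
  -- 1) ^ 4`.
  have h₆ : φ.numVars + 1 ≤ (φ.numVars + 1) ^ 4 := Nat.le_self_pow (by norm_num) _
  have h₇ : (2 * (φ.numVars + 1)) ^ 3 * (8 * (φ.numVars + 1)) = 64 * (φ.numVars + 1) ^ 4 := by
    ring
  rw [code, List.length_append, listCode, List.length_append, List.length_singleton, unaryCode,
    List.length_append, List.length_replicate, List.length_singleton]
  omega

end CNFFormula

theorem exists_pow_le (m : ℕ) {r : ℝ} (hr : 1 < r) :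
    ∃ M : ℝ, 0 ≤ M ∧ ∀ n : ℕ, ((n : ℝ) + 1) ^ m ≤ M * r ^ n := by
  obtain ⟨M, hM, h⟩ := Asymptotics.bound_of_isBigO_nat_atTop
    (isLittleO_pow_const_const_pow_of_one_lt (R := ℝ) m hr).isBigO
  have hr0 : 0 < r := one_pos.trans hr
  refine ⟨M * r, by positivity, fun n => ?_⟩
  have := h (x := n + 1) (pow_ne_zero _ hr0.ne')
  rw [Real.norm_of_nonneg (by positivity), Real.norm_of_nonneg (by positivity), pow_succ] at this
  push_cast at this
  linarith

theorem exists_le_add_mul {f : ℕ → ℝ} (hf : f =o[Filter.atTop] fun k : ℕ => (k : ℝ)) {ε : ℝ}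
    (hε : 0 < ε) : ∃ K : ℝ, ∀ k : ℕ, f k ≤ K + ε * k := by
  obtain ⟨k₀, h⟩ := Filter.eventually_atTop.1 (hf.def hε)
  refine ⟨∑ k ∈ Finset.range k₀, |f k|, fun k => ?_⟩
  rcases lt_or_ge k k₀ with hk | hk
  · have h₁ := Finset.single_le_sum (f := fun k => |f k|) (fun _ _ => abs_nonneg _)
      (Finset.mem_range.2 hk)
    have h₂ : 0 ≤ ε * k := by positivity
    have h₃ := le_abs_self (f k)
    linarith
  · have h₁ : 0 ≤ ∑ k ∈ Finset.range k₀, |f k| := Finset.sum_nonneg fun _ _ => abs_nonneg _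
    have h₂ := h k hk
    rw [Real.norm_eq_abs, Real.norm_of_nonneg (by positivity)] at h₂
    have h₃ := le_abs_self (f k)
    linarith

theorem exists_rpow_le {f : ℕ → ℝ} (hf : f =o[Filter.atTop] fun k : ℕ => (k : ℝ)) :
    ∃ D : ℝ, 0 ≤ D ∧ ∀ B n : ℕ, 0 < B → B ≤ 68 * (n + 1) ^ 4 →
      (2 : ℝ) ^ f (72 * (72 * Nat.size B) + 4) ≤ D * √((n : ℝ) + 1) := by
  -- Here `41472 = 8 * 72 * 72`, so the exponent is at most `Nat.size B / 8` up to a constant. As `2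
  -- ^ Nat.size B ≤ 2 * B = O((n + 1) ^ 4)`, the eighth root gives `√(n + 1)`.
  obtain ⟨K, hK⟩ := exists_le_add_mul hf (ε := 1 / 41472) (by norm_num)
  refine ⟨(2 : ℝ) ^ (K + 1) * 136 ^ (1 / 8 : ℝ), by positivity, fun B n hB hBn => ?_⟩
  have h₁ : (2 : ℝ) ^ Nat.size B ≤ 136 * ((n : ℝ) + 1) ^ 4 := by
    have hs : 0 < Nat.size B := Nat.size_pos.2 hB
    have h := Nat.lt_size.1 (Nat.sub_lt hs one_pos)
    have h2 : 2 ^ Nat.size B = 2 ^ (Nat.size B - 1) * 2 := by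
      rw [← pow_succ, Nat.sub_add_cancel hs]
    have h3 : 2 ^ Nat.size B ≤ 136 * (n + 1) ^ 4 := by omega
    exact_mod_cast h3
  have h₂ : f (72 * (72 * Nat.size B) + 4) ≤ K + 1 + Nat.size B * (1 / 8) := by
    have := hK (72 * (72 * Nat.size B) + 4)
    push_cast at this
    linarith
  calc (2 : ℝ) ^ f (72 * (72 * Nat.size B) + 4)
      ≤ 2 ^ (K + 1 + Nat.size B * (1 / 8)) := Real.rpow_le_rpow_of_exponent_le one_le_two h₂
    _ = 2 ^ (K + 1) * ((2 : ℝ) ^ Nat.size B) ^ (1 / 8 : ℝ) := by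
        rw [Real.rpow_add two_pos, Real.rpow_mul two_pos.le, Real.rpow_natCast]
    _ ≤ 2 ^ (K + 1) * (136 * ((n : ℝ) + 1) ^ 4) ^ (1 / 8 : ℝ) := by gcongr
    _ = _ := by
        rw [Real.mul_rpow (by norm_num) (by positivity), ← Real.rpow_natCast,
          ← Real.rpow_mul (by positivity), Real.sqrt_eq_rpow, mul_assoc]
        norm_num

/-- The budget `2 ^ (c * n)` is split into two factors `r ^ n`, one for the doubly exponential term
and one for the power of the number of vertices. -/
theorem exists_time_le {f : ℕ → ℝ} (hf : f =o[Filter.atTop] fun k : ℕ => (k : ℝ)) (A : ℝ)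
    (C d : ℕ) {c : ℝ} (hc : 0 < c) : ∃ A' : ℝ, ∀ B n : ℕ, 0 < B → B + 2 ≤ 68 * (n + 1) ^ 4 →
      ((B + 2 : ℕ) : ℝ) ^ C + A * ((2 : ℝ) ^ ((2 : ℝ) ^ f (72 * (72 * Nat.size B) + 4)) *
        ((max 1 (9 * B + (72 * (72 * Nat.size B) + 2)) : ℕ) : ℝ) ^ d) ≤ A' * 2 ^ (c * n) := by
  obtain ⟨D, hD, hfD⟩ := exists_rpow_le hf
  set r : ℝ := 2 ^ (c / 2) with hr
  have hr1 : 1 < r := Real.one_lt_rpow one_lt_two (by positivity)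
  have hr0 : 0 < r := one_pos.trans hr1
  have hrn : ∀ n : ℕ, r ^ n = 2 ^ (c / 2 * n) := fun n => by
    rw [hr, Real.rpow_mul two_pos.le, Real.rpow_natCast]
  obtain ⟨M₁, hM₁, h₁⟩ := exists_pow_le (4 * C) hr1
  obtain ⟨M₂, hM₂, h₂⟩ := exists_pow_le (4 * d) hr1
  set E : ℝ := 2 ^ (c / 2 + D ^ 2 / (2 * c)) with hE
  refine ⟨68 ^ C * M₁ + |A| * (E * (5193 * 68) ^ d * M₂), fun B n hB hBn => ?_⟩
  have hsq : (2 : ℝ) ^ (c * n) = r ^ n * r ^ n := by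
    rw [hrn, ← Real.rpow_add two_pos]
    ring_nf
  have hB' : ((B + 2 : ℕ) : ℝ) ≤ 68 * ((n : ℝ) + 1) ^ 4 := by exact_mod_cast hBn
  have t₁ : ((B + 2 : ℕ) : ℝ) ^ C ≤ 68 ^ C * M₁ * (r ^ n * r ^ n) := by
    calc ((B + 2 : ℕ) : ℝ) ^ C ≤ (68 * ((n : ℝ) + 1) ^ 4) ^ C := by gcongr
      _ = 68 ^ C * ((n : ℝ) + 1) ^ (4 * C) := by rw [mul_pow, pow_mul]
      _ ≤ 68 ^ C * (M₁ * (r ^ n * r ^ n)) := by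
          gcongr
          refine (h₁ n).trans ?_
          gcongr
          exact le_mul_of_one_le_left (by positivity) (one_le_pow₀ hr1.le)
      _ = _ := by ring
  have t₂ : ((max 1 (9 * B + (72 * (72 * Nat.size B) + 2)) : ℕ) : ℝ) ^ d ≤
      (5193 * 68) ^ d * M₂ * r ^ n := by
    have hN : max 1 (9 * B + (72 * (72 * Nat.size B) + 2)) ≤ 5193 * (B + 2) := by
      have : Nat.size B ≤ B := Nat.size_le.2 Nat.lt_two_pow_self
      omega
    have hN' : ((max 1 (9 * B + (72 * (72 * Nat.size B) + 2)) : ℕ) : ℝ) ≤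
        5193 * (68 * ((n : ℝ) + 1) ^ 4) := by
      refine (Nat.cast_le.2 hN).trans ?_
      rw [Nat.cast_mul]
      push_cast at hB' ⊢
      linarith
    calc _ ≤ (5193 * (68 * ((n : ℝ) + 1) ^ 4)) ^ d := by gcongr
      _ = (5193 * 68) ^ d * ((n : ℝ) + 1) ^ (4 * d) := by rw [← mul_assoc, mul_pow, pow_mul]
      _ ≤ (5193 * 68) ^ d * (M₂ * r ^ n) := by gcongr; exact h₂ n
      _ = _ := by ring
  have t₃ : (2 : ℝ) ^ ((2 : ℝ) ^ f (72 * (72 * Nat.size B) + 4)) ≤ E * r ^ n := by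
    rw [hrn, hE, ← Real.rpow_add two_pos]
    refine Real.rpow_le_rpow_of_exponent_le one_le_two ((hfD B n hB (by omega)).trans ?_)
    have hs := Real.sq_sqrt (show (0 : ℝ) ≤ (n : ℝ) + 1 by positivity)
    -- Completing the square yields `D * √(n + 1) ≤ c / 2 * (n + 1) + D ^ 2 / (2 * c)`, which
    -- explains the constant `E`.
    have key : 0 ≤ (c * √((n : ℝ) + 1) - D) ^ 2 / (2 * c) := by positivity
    have : (c * √((n : ℝ) + 1) - D) ^ 2 / (2 * c) =
        c / 2 * √((n : ℝ) + 1) ^ 2 - D * √((n : ℝ) + 1) + D ^ 2 / (2 * c) := by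
      field_simp
      ring
    rw [hs] at this
    linarith
  rw [hsq, add_mul]
  refine add_le_add t₁ ?_
  calc A * _ ≤ |A| * ((E * r ^ n) * ((5193 * 68) ^ d * M₂ * r ^ n)) := by
        refine (mul_le_mul_of_nonneg_right (le_abs_self A) (by positivity)).trans ?_
        gcongr
    _ = _ := by ring

open FormulaGraph CNFCode in
/-- An algorithm for Edge Clique Cover yields one for satisfiability. -/
theorem ECCSolvableInTime.exists_decidesInTime {f : ℕ → ℝ} {d : ℕ} (h : ECCSolvableInTime f d) :
    ∃ (A : ℝ) (C : ℕ), DecidesInTime (CNFFormula.code (w := 3)) CNFFormula.Satisfiable fun φ =>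
      ((φ.code.length + 2 : ℕ) : ℝ) ^ C +
        A * ((2 : ℝ) ^ ((2 : ℝ) ^ f (72 * (72 * Nat.size φ.code.length) + 4)) *
          ((max 1 (9 * φ.code.length + (72 * (72 * Nat.size φ.code.length) + 2)) : ℕ) : ℝ) ^ d) := by
  obtain ⟨A, hA⟩ := h
  have hr : ∀ φ : CNFFormula 3, (graphInstance (litVar φ.code) (litSgn φ.code)
      (Nat.size φ.code.length) φ.code.length).HasCover ↔ φ.Satisfiable := fun φ => by
    rw [satisfiable_iff]
    -- The length of the code bounds both the number of clauses and all indices of variables, so it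
    -- serves as `B`, and its binary length as the number of digit positions.
    exact hasCover_graphInstance_iff _ _ (Nat.size_pos.2 ((Nat.zero_le _).trans_lt
      (numVars_lt φ))) (Nat.lt_size_self _).le (litVar_lt φ) (litSgn_lt φ.code)
  obtain ⟨C, hC⟩ := hA.of_out _ hr instanceOut fun φ => emit_instanceOut _ _
  refine ⟨A, C, ?_⟩
  simpa only [graphInstance, length_nodes] using hC

theorem corollary1 (eth : ExponentialTimeHypothesis) :
    ¬ ∃ (f : ℕ → ℝ) (d : ℕ), f =o[Filter.atTop] (fun k : ℕ => (k : ℝ)) ∧ ECCSolvableInTime f d := by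
  rintro ⟨f, d, hf, h⟩
  obtain ⟨A, C, hdec⟩ := h.exists_decidesInTime
  -- For `c` strictly between `0` and the exponent, the reduction gives time `O(2 ^ (c * n))`, so
  -- the infimum would be at most `c`.
  obtain ⟨c, hc, hc'⟩ := ENNReal.lt_iff_exists_nnreal_btwn.1 eth
  have hc0 : (0 : ℝ) < c := by exact_mod_cast hc
  refine hc'.not_ge ?_
  obtain ⟨A', hA'⟩ := exists_time_le hf A C d hc0
  refine (iInf₂_le (c : ℝ) ⟨hc0, A', hdec.mono fun φ => ?_⟩).trans_eq ENNReal.ofReal_coe_nnreal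
  exact hA' _ _ ((Nat.zero_le _).trans_lt (CNFCode.numVars_lt φ)) φ.length_code_le
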